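/- Let $\rho>0$ and $\beta\in(0,1)$. For a convex $F:\mathbb R^n\to\mathbb R$ and $x_0\in\mathbb R^n$, the bundle method (with no stopping criterion) sets $z_0=x_0$, selects $g_0\in\partial F(z_0)$, and for $k=0,1,2,\dots$ computes $$z_{k+1}=\operatorname{argmin}_{x}\ \widetilde F^k(x)+\tfrac{\rho}{2}\|x-x_k\|^2,$$ sets $x_{k+1}=z_{k+1}$ if $F(z_{k+1})\le F(x_k)-\beta\,(F(x_k)-\widetilde F^k(z_{k+1}))$ and $x_{k+1}=x_k$ otherwise, and selects $g_{k+1}\in\partial F(z_{k+1})$. With $c_j(x)=F(z_j)+\langle g_j,x-z_j\rangle$, the model $\widetilde F^k$ is one of the following. * Multiple cuts: $\widetilde F^k=\max_{j\in J_k}c_j$, where $J_0=\{0\}$ and $J_{k+1}$ is any set with $$\{k+1\}\cup\{j\in J_k: c_j(z_{k+1})=\widetilde F^k(z_{k+1})\}\subseteq J_{k+1}\subseteq J_k\cup\{k+1\}.$$ * Cut aggregation: $\widetilde F^k=\max\{c_k,\bar F^k\}$, where $\bar F^0=-\infty$, $\bar F^{k+1}=\theta_k\bar F^k+(1-\theta_k)c_k$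 (so $\theta_0=0$ and $\bar F^1=c_0$), and $\theta_k\in[0,1]$ is such that $\nabla\bar F^{k+1}=\rho(x_k-z_{k+1})$, the subgradient of $\widetilde F^k$ at $z_{k+1}$ given by the optimality condition of the subproblem. Let $F$ be convex and attain its minimum, let $x^*$ be any minimizer of $F$, and consider any run of either version. Put $L=\sup_k\|g_k\|$, $R=\|x_0-x^*\|$ and $\bar D^2=2\left(1+\frac{1-\beta}{\beta}\right)\left(R^2+\frac{L^2}{\rho^2}\right)$, $\bar D\ge 0$. For $D,\epsilon>0$ let $\bar\alpha=\min\{1,\epsilon/(\rho D^2)\}$ and $$B(D,\epsilon)=\frac{8L^2}{\rho(1-\beta)^2\bar{\alpha}\epsilon}\ln\left(\frac{L^2}{2\rho\bar{\alpha}\epsilon}\right) + \ln\left(\frac{F(x_0) - F(x^*)}{\beta\bar{\alpha}\epsilon}\right)\left[\frac{8L^2}{\rho(1-\beta)^2 \beta\bar{\alpha}^2\epsilon}\ln\left(\frac{9}{2\bar{\alpha}^2\beta^2}\right) + \frac{2}{\beta\bar{\alpha}}\right] + 2,$$ where $\ln 0$ is read as $0$ (relevant only when $x_0$ is already a minimizer).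 Then: 1. $L<\infty$, and $\|z_k-x^*\|\le\bar D$ for all $k\ge0$. 2. For every $D>0$ with $D\ge\bar D$ and every $\epsilon>0$ there is $k\le\max\{0,B(D,\epsilon)\}$ with $F(x_k)-F(x^*)\le\epsilon$. 3. The same holds for every $D>0$ with $\|z_k-x^*\|\le D$ for all $k$, and every $0<\epsilon\le\rho D^2/4$. 4. Up to logarithmic factors the bound is of order $\|x_0-x^*\|^4/\epsilon^3$: for all $L_0,r>0$ there is a constant $C>0$, depending only on $\rho,\beta,L_0,r$, such that for all $n$, all such $F$, $x^*$ and runs with $L\le L_0$ and $R\ge r$, and all $0<\epsilon\le1$, $$B(\bar D,\epsilon)\le C\,\frac{R^4}{\epsilon^3}\left(1+\ln\left(1+\frac{R}{\epsilon}\right)\right)^2.$$ -/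

import Mathlib

noncomputable section

/-- `g ∈ ∂F(x)`: the vector `g` is a subgradient of `F` at `x`. -/
def IsSubgradient {n : ℕ} (F : EuclideanSpace ℝ (Fin n) → ℝ)
    (x g : EuclideanSpace ℝ (Fin n)) : Prop :=
  ∀ y, F x + inner ℝ g (y - x) ≤ F y

/-- The `j`-th cut `y ↦ F(z_j) + ⟨g_j, y - z_j⟩`. -/
def cut {n : ℕ} (F : EuclideanSpace ℝ (Fin n) → ℝ) (z g : ℕ → EuclideanSpace ℝ (Fin n))
    (j : ℕ) (y : EuclideanSpace ℝ (Fin n)) : ℝ :=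
  F (z j) + inner ℝ (g j) (y - z j)

/-- The part of the bundle method (with no stopping criterion) that is common to both versions:
`model k` is the lower approximation of `F` used in iteration `k`, `x k` is the current best point,
`z k` is the point where the `k`-th subgradient `g k` is taken. -/
structure IsBundleIteration {n : ℕ} (F : EuclideanSpace ℝ (Fin n) → ℝ) (ρ β : ℝ)
    (model : ℕ → EuclideanSpace ℝ (Fin n) → ℝ)
    (x z g : ℕ → EuclideanSpace ℝ (Fin n)) : Prop where
  init : z 0 = x 0
  subgradient : ∀ k, IsSubgradient F (z k) (g k)
  /-- `z (k + 1)` solves the proximal subproblem. -/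
  subproblem : ∀ k y, model k (z (k + 1)) + ρ / 2 * ‖z (k + 1) - x k‖ ^ 2 ≤
    model k y + ρ / 2 * ‖y - x k‖ ^ 2
  descent_step : ∀ k, F (z (k + 1)) ≤ F (x k) - β * (F (x k) - model k (z (k + 1))) →
    x (k + 1) = z (k + 1)
  null_step : ∀ k, ¬ F (z (k + 1)) ≤ F (x k) - β * (F (x k) - model k (z (k + 1))) →
    x (k + 1) = x k

/-- The maximum of the cuts with index in the finite set `J`. (In the method below `k ∈ J k`,
so the maximum is always over a nonempty finite set.) -/
def multipleCutModel {n : ℕ} (F : EuclideanSpace ℝ (Fin n) → ℝ)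
    (z g : ℕ → EuclideanSpace ℝ (Fin n)) (J : Finset ℕ) (y : EuclideanSpace ℝ (Fin n)) : ℝ :=
  ⨆ j : J, cut F z g j y

/-- `(x, z, g)` is a run of the bundle method with multiple cuts on `F`: after each iteration the
newest cut and all cuts active at `z (k + 1)` are kept, and any of the others may be dropped. -/
def IsMultipleCutRun {n : ℕ} (F : EuclideanSpace ℝ (Fin n) → ℝ) (ρ β : ℝ)
    (x z g : ℕ → EuclideanSpace ℝ (Fin n)) : Prop :=
  ∃ J : ℕ → Finset ℕ,
    J 0 = {0} ∧
    (∀ k, J (k + 1) ⊆ insert (k + 1) (J k)) ∧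
    (∀ k, k + 1 ∈ J (k + 1)) ∧
    (∀ k, ∀ j ∈ J k, cut F z g j (z (k + 1)) = multipleCutModel F z g (J k) (z (k + 1)) →
      j ∈ J (k + 1)) ∧
    IsBundleIteration F ρ β (fun k => multipleCutModel F z g (J k)) x z g

/-- `aggregate F z g θ k` is the aggregated cut `F̄^{k+1}`. As `F̄^0 = -∞`, the first aggregated cut
is `F̄^1 = cut 0` (that is, `θ_0 = 0`); then
`F̄^{k+2} = θ_{k+1} F̄^{k+1} + (1 - θ_{k+1}) (cut (k+1))`. -/
def aggregate {n : ℕ} (F : EuclideanSpace ℝ (Fin n) → ℝ)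
    (z g : ℕ → EuclideanSpace ℝ (Fin n)) (θ : ℕ → ℝ) : ℕ → EuclideanSpace ℝ (Fin n) → ℝ
  | 0 => cut F z g 0
  | k + 1 => fun y =>
      θ (k + 1) * aggregate F z g θ k y + (1 - θ (k + 1)) * cut F z g (k + 1) y

/-- The model `F̃^k = max {cut k, F̄^k}` (with `F̄^0 = -∞`). -/
def aggregateModel {n : ℕ} (F : EuclideanSpace ℝ (Fin n) → ℝ)
    (z g : ℕ → EuclideanSpace ℝ (Fin n)) (θ : ℕ → ℝ) : ℕ → EuclideanSpace ℝ (Fin n) → ℝ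
  | 0 => cut F z g 0
  | k + 1 => fun y => max (cut F z g (k + 1) y) (aggregate F z g θ k y)

/-- `(x, z, g)` is a run of the bundle method with cut aggregation on `F`: the gradient of the
affine function `F̄^{k+1}` is `ρ (x_k - z_{k+1})`, the subgradient of `F̃^k` at `z_{k+1}` that
satisfies the optimality condition `0 ∈ ∂F̃^k(z_{k+1}) + ρ (z_{k+1} - x_k)`. -/
def IsAggregationRun {n : ℕ} (F : EuclideanSpace ℝ (Fin n) → ℝ) (ρ β : ℝ)
    (x z g : ℕ → EuclideanSpace ℝ (Fin n)) : Prop :=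
  ∃ θ : ℕ → ℝ,
    (∀ k, 0 ≤ θ k ∧ θ k ≤ 1) ∧
    (∀ k y, HasGradientAt (aggregate F z g θ k) (ρ • (x k - z (k + 1))) y) ∧
    IsBundleIteration F ρ β (aggregateModel F z g θ) x z g

/-- A run of the bundle method, in either of its two versions. -/
def IsBundleRun {n : ℕ} (F : EuclideanSpace ℝ (Fin n) → ℝ) (ρ β : ℝ)
    (x z g : ℕ → EuclideanSpace ℝ (Fin n)) : Prop :=
  IsMultipleCutRun F ρ β x z g ∨ IsAggregationRun F ρ β x z g

/-- `L = sup_k ‖g_k‖` (the theorem asserts that the supremum is finite). -/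
def subgradientBound {n : ℕ} (g : ℕ → EuclideanSpace ℝ (Fin n)) : ℝ :=
  ⨆ k, ‖g k‖

/-- The explicit bound `√(2 (1 + (1-β)/β) (R² + L²/ρ²))` for the distance of the iterates to a
minimizer, where `R = ‖x₀ - x*‖`. -/
def distanceBound (ρ β L R : ℝ) : ℝ :=
  Real.sqrt (2 * (1 + (1 - β) / β) * (R ^ 2 + L ^ 2 / ρ ^ 2))

/-- The iteration bound under quadratic growth, as a function of `a = ᾱ`, where
`gap = F(x₀) - F(x*)`. -/
def growthRate (ρ β L gap ε a : ℝ) : ℝ :=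
  8 * L ^ 2 / (ρ * (1 - β) ^ 2 * a * ε) * Real.log (L ^ 2 / (2 * ρ * a * ε)) +
    Real.log (gap / (β * a * ε)) *
      (8 * L ^ 2 / (ρ * (1 - β) ^ 2 * β * a ^ 2 * ε) * Real.log (9 / (2 * a ^ 2 * β ^ 2)) +
        2 / (β * a)) + 2

/-- The iteration bound for general convex functions: `ᾱ = min {1, ε / (ρ D²)}`. -/
def bundleRate (ρ β L gap D ε : ℝ) : ℝ :=
  growthRate ρ β L gap ε (min 1 (ε / (ρ * D ^ 2)))

end

/-! Both versions enter only through `IsCutModelRun`. The driving quantity is `proxGap`, written δ_k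
below. Testing the subproblem at x_k + a(x* - x_k) with a = ε/(ρD²) gives δ_k ≥ (a/2)(F(x_k) -
F(x*)) as long as F(x_k) - F(x*) > ε (`proxGap_ge_of_dist`). A descent step gains at least βδ_k, so
it shrinks the objective gap by the factor 1 - βa/2.

When a null step follows a null step, the next model dominates the newest cut and the last
linearization. Averaging these two with the best weight gives δ_{k+1} ≤ δ_k - cδ_k²
(`proxGap_succ_le`, `proxGap_null_step_le`). Hence 1/(cδ) grows by at least 1 while δ ≥ aε/2 keeps
it bounded, which limits the length of a run of null steps. `index_le` adds up both kinds of steps,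
and `iteration_count_le` compares the count with the stated B.

The centers stay bounded because ‖x_k - x*‖² plus a multiple of the objective gap never increases
(`lyapunov_succ_le`). Finiteness of L also needs bounded trial points, hence a bound on δ_k obtained
without L (`exists_proxGap_bound`). -/

/-- Iteration `k` is a null step: the test for a descent step fails. -/
def IsNullStep {n : ℕ} (F : EuclideanSpace ℝ (Fin n) → ℝ) (β : ℝ)
    (model : ℕ → EuclideanSpace ℝ (Fin n) → ℝ) (x z : ℕ → EuclideanSpace ℝ (Fin n))
    (k : ℕ) : Prop :=
  ¬ F (z (k + 1)) ≤ F (x k) - β * (F (x k) - model k (z (k + 1)))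

/-- The properties of the models, shared by the two versions of the bundle method, on which the
convergence analysis rests. The linearization of the model at the solution of the subproblem is
only required to survive in the next model when the iteration is the second of two consecutive
null steps. -/
structure IsCutModelRun {n : ℕ} (F : EuclideanSpace ℝ (Fin n) → ℝ) (ρ β : ℝ)
    (model : ℕ → EuclideanSpace ℝ (Fin n) → ℝ)
    (x z g : ℕ → EuclideanSpace ℝ (Fin n)) : Prop
    extends IsBundleIteration F ρ β model x z g where
  model_le : ∀ k y, model k y ≤ F y
  cut_le : ∀ k y, cut F z g k y ≤ model k y
  subgradient_model : ∀ k y, model k (z (k + 1)) +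
    inner ℝ (ρ • (x k - z (k + 1))) (y - z (k + 1)) ≤ model k y
  norm_le : ∀ G, (∀ j, ‖g j‖ ≤ G) → ∀ k, ‖ρ • (x k - z (k + 1))‖ ≤ G
  linearization_le : ∀ k y, IsNullStep F β model x z k → IsNullStep F β model x z (k + 1) →
    model (k + 1) (z (k + 2)) + inner ℝ (ρ • (x (k + 1) - z (k + 2))) (y - z (k + 2)) ≤
      model (k + 2) y

/-! ### Optimality condition of the proximal subproblem. -/

section Prox

variable {E : Type*} [NormedAddCommGroup E] [InnerProductSpace ℝ E]

/-- Comparing z with z + t(y - z), dividing by t and letting t → 0 removes the quadratic remainder.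
Only convexity along segments issuing from z is needed. -/
theorem prox_subgradient {f : E → ℝ} {ρ : ℝ} {x z : E}
    (hf : ∀ y t, 0 ≤ t → t ≤ 1 → f (z + t • (y - z)) ≤ (1 - t) * f z + t * f y)
    (hz : ∀ y, f z + ρ / 2 * ‖z - x‖ ^ 2 ≤ f y + ρ / 2 * ‖y - x‖ ^ 2) (y : E) :
    f z + inner ℝ (ρ • (x - z)) (y - z) ≤ f y := by
  set w := y - z with hw
  have key : ∀ t : ℝ, t ∈ Set.Ioc (0 : ℝ) 1 →
      0 ≤ f y - f z - inner ℝ (ρ • (x - z)) w + t * (ρ / 2 * ‖w‖ ^ 2) := by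
    intro t ht
    have h1 := hz (z + t • w)
    have h2 := hf y t ht.1.le ht.2
    have h3 : ‖z + t • w - x‖ ^ 2 =
        ‖z - x‖ ^ 2 - 2 * t * inner ℝ (x - z) w + t ^ 2 * ‖w‖ ^ 2 := by
      have : z + t • w - x = (z - x) + t • w := by abel
      rw [this, norm_add_sq_real, inner_smul_right, norm_smul, mul_pow, Real.norm_eq_abs, sq_abs,
        ← neg_sub x z, inner_neg_left]
      ring
    rw [h3] at h1
    rw [real_inner_smul_left]
    have h4 : 0 ≤ t * (f y - f z - ρ * inner ℝ (x - z) w + t * (ρ / 2 * ‖w‖ ^ 2)) := by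
      nlinarith
    exact nonneg_of_mul_nonneg_right h4 ht.1
  have hlim : Filter.Tendsto
      (fun t : ℝ => f y - f z - inner ℝ (ρ • (x - z)) w + t * (ρ / 2 * ‖w‖ ^ 2))
      (nhdsWithin 0 (Set.Ioi 0)) (nhds (f y - f z - inner ℝ (ρ • (x - z)) w)) := by
    have : ContinuousAt
        (fun t : ℝ => f y - f z - inner ℝ (ρ • (x - z)) w + t * (ρ / 2 * ‖w‖ ^ 2)) 0 := by
      fun_prop
    simpa [ContinuousAt] using this.tendsto.mono_left nhdsWithin_le_nhds
  have := ge_of_tendsto hlim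
    (Filter.eventually_of_mem (Ioc_mem_nhdsGT zero_lt_one) key)
  linarith

/-- For affine data, a strict inequality persists a short way along any ray. -/
theorem exists_small_step {ι : Type*} (s : Finset ι) (u v : ι → ℝ) (h : ∀ i ∈ s, u i < 0) :
    ∃ t : ℝ, 0 < t ∧ t ≤ 1 ∧ ∀ i ∈ s, u i + t * v i < 0 := by
  have h1 : ∀ᶠ t in nhdsWithin (0 : ℝ) (Set.Ioi 0), ∀ i ∈ s, u i + t * v i < 0 := by
    rw [Filter.eventually_all_finset]
    intro i hi
    have : ContinuousAt (fun t : ℝ => u i + t * v i) 0 := by fun_prop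
    exact (this.eventually_lt continuousAt_const (by simpa using h i hi)).filter_mono
      nhdsWithin_le_nhds
  obtain ⟨t, h2, h3⟩ := (h1.and (Ioc_mem_nhdsGT (zero_lt_one (α := ℝ)))).exists
  exact ⟨t, h3.1, h3.2, h2⟩

end Prox

/-! ### The two cut models satisfy the common axioms. -/

section Models

variable {n : ℕ} {F : EuclideanSpace ℝ (Fin n) → ℝ} {ρ β : ℝ}
  {x z g : ℕ → EuclideanSpace ℝ (Fin n)}

theorem cut_eq (j : ℕ) (y w : EuclideanSpace ℝ (Fin n)) :
    cut F z g j y = cut F z g j w + inner ℝ (g j) (y - w) := by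
  have : y - z j = (w - z j) + (y - w) := by abel
  simp only [cut]
  rw [this, inner_add_right, add_assoc]

theorem cut_self (j : ℕ) : cut F z g j (z j) = F (z j) := by
  simp [cut]

theorem cut_line (j : ℕ) (w y : EuclideanSpace ℝ (Fin n)) (t : ℝ) :
    cut F z g j (w + t • (y - w)) = (1 - t) * cut F z g j w + t * cut F z g j y := by
  rw [cut_eq j (w + t • (y - w)) w, cut_eq j y w, add_sub_cancel_left, inner_smul_right]
  ring

theorem cut_le_multipleCutModel {J : Finset ℕ} {j : ℕ} (hj : j ∈ J)
    (y : EuclideanSpace ℝ (Fin n)) : cut F z g j y ≤ multipleCutModel F z g J y :=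
  le_ciSup (f := fun i : J => cut F z g i y) (Set.finite_range _).bddAbove ⟨j, hj⟩

theorem exists_multipleCutModel_eq {J : Finset ℕ} (hJ : J.Nonempty)
    (y : EuclideanSpace ℝ (Fin n)) : ∃ j ∈ J, multipleCutModel F z g J y = cut F z g j y := by
  have : Nonempty J := hJ.to_subtype
  obtain ⟨j, hj⟩ := exists_eq_ciSup_of_finite (f := fun i : J => cut F z g i y)
  exact ⟨j, j.2, hj.symm⟩

theorem multipleCutModel_line {J : Finset ℕ} (hJ : J.Nonempty) (w y : EuclideanSpace ℝ (Fin n))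
    (t : ℝ) (h0 : 0 ≤ t) (h1 : t ≤ 1) : multipleCutModel F z g J (w + t • (y - w)) ≤
      (1 - t) * multipleCutModel F z g J w + t * multipleCutModel F z g J y := by
  obtain ⟨j, hj, h⟩ := exists_multipleCutModel_eq (F := F) (z := z) (g := g) hJ (w + t • (y - w))
  rw [h, cut_line]
  have h2 : 0 ≤ 1 - t := sub_nonneg.2 h1
  gcongr
  · exact cut_le_multipleCutModel hj w
  · exact cut_le_multipleCutModel hj y

/-- A subgradient of a maximum of cuts is a subgradient of the maximum of the active ones. -/
theorem linearization_le_multipleCutModel {J J' : Finset ℕ} (hJ : J.Nonempty)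
    {w s : EuclideanSpace ℝ (Fin n)}
    (hactive : ∀ j ∈ J, cut F z g j w = multipleCutModel F z g J w → j ∈ J')
    (hs : ∀ y, multipleCutModel F z g J w + inner ℝ s (y - w) ≤ multipleCutModel F z g J y)
    (y : EuclideanSpace ℝ (Fin n)) :
    multipleCutModel F z g J w + inner ℝ s (y - w) ≤ multipleCutModel F z g J' y := by
  classical
  set M := multipleCutModel F z g J w with hM
  -- After a short enough step towards y, every inactive cut is still below the linearization. The
  -- cut attaining the maximum there is therefore active at w, and since it is affine the inequality
  -- extends from the short step to y.
  obtain ⟨t, ht0, -, ht⟩ := exists_small_step (J.filter fun j => cut F z g j w ≠ M)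
    (fun j => cut F z g j w - M) (fun j => inner ℝ (g j) (y - w) - inner ℝ s (y - w)) (by
      intro j hj
      rw [Finset.mem_filter] at hj
      exact sub_neg.2 (lt_of_le_of_ne (cut_le_multipleCutModel hj.1 w) hj.2))
  obtain ⟨j, hj, h⟩ := exists_multipleCutModel_eq (F := F) (z := z) (g := g) hJ (w + t • (y - w))
  have h1 := hs (w + t • (y - w))
  rw [h, cut_eq j _ w, add_sub_cancel_left, inner_smul_right, inner_smul_right] at h1
  have hjM : cut F z g j w = M := by
    by_contra hne
    have := ht j (Finset.mem_filter.2 ⟨hj, hne⟩)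
    nlinarith
  have h2 : inner ℝ s (y - w) ≤ inner ℝ (g j) (y - w) := by
    rw [hjM] at h1
    exact le_of_mul_le_mul_left (by linarith) ht0
  calc M + inner ℝ s (y - w) ≤ cut F z g j w + inner ℝ (g j) (y - w) := by rw [hjM]; linarith
    _ = cut F z g j y := (cut_eq j y w).symm
    _ ≤ _ := cut_le_multipleCutModel (hactive j hj hjM) y

/-- Moving from w in the direction s itself, the cut attaining the maximum at w + s satisfies ‖s‖² ≤
⟨g_j, s⟩. -/
theorem norm_le_of_subgradient_multipleCutModel {J : Finset ℕ} (hJ : J.Nonempty)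
    {w s : EuclideanSpace ℝ (Fin n)}
    (hs : ∀ y, multipleCutModel F z g J w + inner ℝ s (y - w) ≤ multipleCutModel F z g J y)
    {G : ℝ} (hG : ∀ j, ‖g j‖ ≤ G) : ‖s‖ ≤ G := by
  obtain ⟨j, hj, h⟩ := exists_multipleCutModel_eq (F := F) (z := z) (g := g) hJ (w + s)
  have h1 := hs (w + s)
  rw [h, cut_eq j _ w, add_sub_cancel_left, real_inner_self_eq_norm_sq] at h1
  have h2 := cut_le_multipleCutModel (F := F) (z := z) (g := g) hj w
  have h3 := real_inner_le_norm (g j) s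
  have h4 := hG j
  rcases (norm_nonneg s).eq_or_lt with h0 | h0
  · rw [← h0]; exact (norm_nonneg _).trans h4
  · refine h4.trans' (le_of_mul_le_mul_right ?_ h0)
    nlinarith

theorem IsMultipleCutRun.isCutModelRun (h : IsMultipleCutRun F ρ β x z g) :
    ∃ model, IsCutModelRun F ρ β model x z g := by
  obtain ⟨J, hJ0, -, hJmem, hJact, hb⟩ := h
  have hmem : ∀ k, k ∈ J k := by
    rintro (_ | k)
    · simp [hJ0]
    · exact hJmem k
  have hne : ∀ k, (J k).Nonempty := fun k => ⟨k, hmem k⟩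
  have hsub : ∀ k y, multipleCutModel F z g (J k) (z (k + 1)) +
      inner ℝ (ρ • (x k - z (k + 1))) (y - z (k + 1)) ≤ multipleCutModel F z g (J k) y :=
    fun k => prox_subgradient (fun y t => multipleCutModel_line (hne k) _ y t) (hb.subproblem k)
  refine ⟨_, { hb with
    model_le := fun k y => ?_
    cut_le := fun k y => cut_le_multipleCutModel (hmem k) y
    subgradient_model := hsub
    norm_le := fun G hG k => norm_le_of_subgradient_multipleCutModel (hne k) (hsub k) hG
    linearization_le := fun k y _ _ => linearization_le_multipleCutModel (hne (k + 1))
      (hJact (k + 1)) (hsub (k + 1)) y }⟩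
  obtain ⟨j, -, hj⟩ := exists_multipleCutModel_eq (F := F) (z := z) (g := g) (hne k) y
  exact hj.trans_le (hb.subgradient j y)

/-- The gradient of the aggregated cut. -/
def aggregateGradient {n : ℕ} (g : ℕ → EuclideanSpace ℝ (Fin n)) (θ : ℕ → ℝ) :
    ℕ → EuclideanSpace ℝ (Fin n)
  | 0 => g 0
  | k + 1 => θ (k + 1) • aggregateGradient g θ k + (1 - θ (k + 1)) • g (k + 1)

variable {θ : ℕ → ℝ}

theorem aggregate_eq (k : ℕ) (y w : EuclideanSpace ℝ (Fin n)) :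
    aggregate F z g θ k y = aggregate F z g θ k w +
      inner ℝ (aggregateGradient g θ k) (y - w) := by
  induction k with
  | zero => exact cut_eq 0 y w
  | succ k ih =>
    simp only [aggregate, aggregateGradient]
    rw [ih, cut_eq (k + 1) y w, inner_add_left, real_inner_smul_left, real_inner_smul_left]
    ring

theorem hasGradientAt_aggregate (k : ℕ) (y : EuclideanSpace ℝ (Fin n)) :
    HasGradientAt (aggregate F z g θ k) (aggregateGradient g θ k) y := by
  have h : aggregate F z g θ k = fun w => aggregate F z g θ k y +
      (InnerProductSpace.toDual ℝ _ (aggregateGradient g θ k)) (w - y) := by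
    ext w
    rw [aggregate_eq k w y, InnerProductSpace.toDual_apply_apply]
  rw [hasGradientAt_iff_hasFDerivAt, h]
  simp only [map_sub]
  exact ((InnerProductSpace.toDual ℝ _ (aggregateGradient g θ k)).hasFDerivAt
    (x := y)).sub_const (InnerProductSpace.toDual ℝ _ (aggregateGradient g θ k) y)
      |>.const_add (aggregate F z g θ k y)

theorem norm_aggregateGradient_le (hθ : ∀ k, 0 ≤ θ k ∧ θ k ≤ 1) {G : ℝ} (hG : ∀ j, ‖g j‖ ≤ G)
    (k : ℕ) : ‖aggregateGradient g θ k‖ ≤ G := by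
  induction k with
  | zero => exact hG 0
  | succ k ih =>
    obtain ⟨h0, h1⟩ := hθ (k + 1)
    refine (norm_add_le _ _).trans ?_
    rw [norm_smul, norm_smul, Real.norm_of_nonneg h0, Real.norm_of_nonneg (sub_nonneg.2 h1)]
    nlinarith [hG (k + 1)]

theorem aggregate_le (hθ : ∀ k, 0 ≤ θ k ∧ θ k ≤ 1) (hg : ∀ k, IsSubgradient F (z k) (g k))
    (k : ℕ) (y : EuclideanSpace ℝ (Fin n)) : aggregate F z g θ k y ≤ F y := by
  induction k with
  | zero => exact hg 0 y
  | succ k ih =>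
    obtain ⟨h0, h1⟩ := hθ (k + 1)
    have : cut F z g (k + 1) y ≤ F y := hg (k + 1) y
    simp only [aggregate]
    nlinarith

theorem aggregateModel_line (k : ℕ) (w y : EuclideanSpace ℝ (Fin n))
    (t : ℝ) (h0 : 0 ≤ t) (h1 : t ≤ 1) : aggregateModel F z g θ k (w + t • (y - w)) ≤
      (1 - t) * aggregateModel F z g θ k w + t * aggregateModel F z g θ k y := by
  cases k with
  | zero => exact (cut_line 0 w y t).le
  | succ k =>
    have h2 : 0 ≤ 1 - t := by linarith
    have h3 : aggregate F z g θ k (w + t • (y - w)) =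
        (1 - t) * aggregate F z g θ k w + t * aggregate F z g θ k y := by
      rw [aggregate_eq k (w + t • (y - w)) w, aggregate_eq k y w, add_sub_cancel_left,
        inner_smul_right]
      ring
    simp only [aggregateModel]
    rw [cut_line, h3]
    apply max_le <;> gcongr <;> simp

/-- A subgradient of a maximum of two affine functions at a point where the first is strictly
larger is the gradient of the first. -/
theorem eq_of_subgradient_max {E : Type*} [NormedAddCommGroup E] [InnerProductSpace ℝ E]
    {a b : ℝ} (hab : b < a) {p q s : E}
    (hs : ∀ d, a + inner ℝ s d ≤ max (a + inner ℝ p d) (b + inner ℝ q d)) : s = p := by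
  obtain ⟨t, ht0, -, ht⟩ := exists_small_step {()} (fun _ => b - a)
    (fun _ => inner ℝ q (s - p) - inner ℝ s (s - p)) (by simpa using hab)
  have h1 := hs (t • (s - p))
  have h2 := ht () (by simp)
  simp only [inner_smul_right] at h1
  have h3 : 0 ≤ inner ℝ (p - s) (s - p) := by
    rw [inner_sub_left]
    rcases le_max_iff.1 h1 with h | h
    · have : 0 ≤ t * (inner ℝ p (s - p) - inner ℝ s (s - p)) := by linarith
      exact nonneg_of_mul_nonneg_right this ht0
    · nlinarith
  rw [← neg_sub s p, inner_neg_left, real_inner_self_eq_norm_sq] at h3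
  have : ‖s - p‖ = 0 := by nlinarith [norm_nonneg (s - p)]
  exact sub_eq_zero.1 (norm_eq_zero.1 this)

/-- The definition prescribes the gradient of the aggregated cut but not its value, so what has to
be shown is that it touches the model at the new trial point. The gradient determines θ unless the
two affine pieces are parallel; that degenerate case is where the two consecutive null steps are
used. -/
theorem IsAggregationRun.isCutModelRun (hρ : 0 < ρ) (hβ1 : β < 1)
    (h : IsAggregationRun F ρ β x z g) : ∃ model, IsCutModelRun F ρ β model x z g := by
  obtain ⟨θ, hθ, hgrad, hb⟩ := h
  have hs : ∀ k, ρ • (x k - z (k + 1)) = aggregateGradient g θ k :=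
    fun k => (hgrad k 0).unique (hasGradientAt_aggregate k 0)
  have hsub : ∀ k y, aggregateModel F z g θ k (z (k + 1)) +
      inner ℝ (ρ • (x k - z (k + 1))) (y - z (k + 1)) ≤ aggregateModel F z g θ k y :=
    fun k => prox_subgradient (fun y t => aggregateModel_line k _ y t) (hb.subproblem k)
  have hle : ∀ k y, aggregateModel F z g θ k y ≤ F y := by
    rintro (_ | k) y
    · exact hb.subgradient 0 y
    · exact max_le (hb.subgradient (k + 1) y) (aggregate_le hθ hb.subgradient k y)
  refine ⟨_, { hb with
    model_le := hle
    cut_le := ?_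
    subgradient_model := hsub
    norm_le := fun G hG k => hs k ▸ norm_aggregateGradient_le hθ hG k
    linearization_le := ?_ }⟩
  · rintro (_ | k) y
    · exact le_rfl
    · exact le_max_left _ _
  · intro k y hk hk1
    suffices heq : aggregateModel F z g θ (k + 1) (z (k + 2)) =
        aggregate F z g θ (k + 1) (z (k + 2)) by
      rw [heq, hs (k + 1), ← aggregate_eq (k + 1) y (z (k + 2))]
      exact le_max_right _ _
    -- If the pieces are parallel, the newest cut is the upper one: it is exact at z (k + 1), where
    -- the aggregate only minorizes F.
    have hpar : g (k + 1) = aggregateGradient g θ k →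
        aggregate F z g θ k (z (k + 2)) ≤ cut F z g (k + 1) (z (k + 2)) := by
      intro hp
      rw [cut_eq (k + 1) _ (z (k + 1)), aggregate_eq k _ (z (k + 1)), ← hp, cut_self]
      gcongr
      exact aggregate_le hθ hb.subgradient k _
    have hmax : ∀ d, max (cut F z g (k + 1) (z (k + 2)) + inner ℝ (g (k + 1)) d)
        (aggregate F z g θ k (z (k + 2)) + inner ℝ (aggregateGradient g θ k) d) =
          aggregateModel F z g θ (k + 1) (z (k + 2) + d) := by
      intro d
      simp only [aggregateModel]
      rw [cut_eq (k + 1) (z (k + 2) + d) (z (k + 2)),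
        aggregate_eq k (z (k + 2) + d) (z (k + 2)), add_sub_cancel_left]
    have hstep : aggregateGradient g θ (k + 1) =
      θ (k + 1) • aggregateGradient g θ k + (1 - θ (k + 1)) • g (k + 1) := rfl
    have hval : aggregate F z g θ (k + 1) (z (k + 2)) =
      θ (k + 1) * aggregate F z g θ k (z (k + 2)) +
        (1 - θ (k + 1)) * cut F z g (k + 1) (z (k + 2)) := rfl
    have hmodel : aggregateModel F z g θ (k + 1) (z (k + 2)) =
      max (cut F z g (k + 1) (z (k + 2))) (aggregate F z g θ k (z (k + 2))) := rfl
    rcases lt_trichotomy (aggregate F z g θ k (z (k + 2))) (cut F z g (k + 1) (z (k + 2)))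
      with hlt | heq | hgt
    · rw [max_eq_left hlt.le] at hmodel
      have h1 : ρ • (x (k + 1) - z (k + 2)) = g (k + 1) := by
        refine eq_of_subgradient_max hlt (q := aggregateGradient g θ k) fun d => ?_
        rw [hmax, ← hmodel]
        simpa using hsub (k + 1) (z (k + 2) + d)
      have h2 : θ (k + 1) • (aggregateGradient g θ k - g (k + 1)) = 0 := by
        have := (hs (k + 1)).symm.trans h1
        rw [hstep] at this
        rw [smul_sub, sub_eq_zero, ← sub_eq_zero]
        calc _ = (θ (k + 1) • aggregateGradient g θ k + (1 - θ (k + 1)) • g (k + 1)) - g (k + 1) := by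
              module
          _ = 0 := by rw [this, sub_self]
      rcases smul_eq_zero.1 h2 with h3 | h3
      · rw [hmodel, hval, h3]; ring
      -- With equal gradients and an unchanged center the trial point does not move. The model is
      -- then exact at it, so iteration k + 1 would pass the descent test.
      · exfalso
        have hx : x (k + 1) = x k := hb.null_step k hk
        have hz : z (k + 2) = z (k + 1) := by
          have h4 : ρ • (x (k + 1) - z (k + 2)) = ρ • (x k - z (k + 1)) := by
            rw [h1, hs k, sub_eq_zero.1 h3]
          have := smul_right_injective _ hρ.ne' h4
          rw [hx] at this
          exact sub_right_injective this
        have hFm : aggregateModel F z g θ (k + 1) (z (k + 2)) = F (z (k + 2)) := by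
          rw [hmodel, hz, cut_self]
        apply hk1
        have h5 := hb.subproblem (k + 1) (x (k + 1))
        have h6 := hle (k + 1) (x (k + 1))
        rw [show k + 1 + 1 = k + 2 from rfl, hFm] at *
        simp only [sub_self, norm_zero] at h5
        have h7 : 0 ≤ ρ / 2 * ‖z (k + 2) - x (k + 1)‖ ^ 2 := by positivity
        nlinarith
    · rw [hmodel, hval, heq, max_self]; ring
    · rw [max_eq_right hgt.le] at hmodel
      have h1 : ρ • (x (k + 1) - z (k + 2)) = aggregateGradient g θ k := by
        refine eq_of_subgradient_max hgt (q := g (k + 1)) fun d => ?_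
        rw [max_comm, hmax, ← hmodel]
        simpa using hsub (k + 1) (z (k + 2) + d)
      have h2 : (1 - θ (k + 1)) • (g (k + 1) - aggregateGradient g θ k) = 0 := by
        have := (hs (k + 1)).symm.trans h1
        rw [hstep] at this
        calc _ = (θ (k + 1) • aggregateGradient g θ k + (1 - θ (k + 1)) • g (k + 1)) -
              aggregateGradient g θ k := by module
          _ = 0 := by rw [this, sub_self]
      rcases smul_eq_zero.1 h2 with h3 | h3
      · have : θ (k + 1) = 1 := by linarith
        rw [hmodel, hval, this]; ring
      · exact absurd (hpar (sub_eq_zero.1 h3)) (not_le.2 hgt)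

theorem IsBundleRun.isCutModelRun (hρ : 0 < ρ) (hβ1 : β < 1) (h : IsBundleRun F ρ β x z g) :
    ∃ model, IsCutModelRun F ρ β model x z g :=
  h.elim (fun h => h.isCutModelRun) fun h => h.isCutModelRun hρ hβ1

end Models

/-! ### The proximal gap and its one-step estimates. -/

/-- The difference between `F (x k)` and the optimal value of the subproblem of iteration `k`. -/
noncomputable def proxGap {n : ℕ} (F : EuclideanSpace ℝ (Fin n) → ℝ) (ρ : ℝ)
    (model : ℕ → EuclideanSpace ℝ (Fin n) → ℝ) (x z : ℕ → EuclideanSpace ℝ (Fin n))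
    (k : ℕ) : ℝ :=
  F (x k) - model k (z (k + 1)) - ρ / 2 * ‖z (k + 1) - x k‖ ^ 2

theorem neg_sq_le_inner_add_sq {E : Type*} [NormedAddCommGroup E] [InnerProductSpace ℝ E] {ρ : ℝ}
    (hρ : 0 < ρ) (p w : E) : -(‖p‖ ^ 2 / (2 * ρ)) ≤ inner ℝ p w + ρ / 2 * ‖w‖ ^ 2 := by
  have h := abs_real_inner_le_norm p w
  have h1 := neg_abs_le (inner ℝ p w)
  have h2 : 0 ≤ (‖p‖ - ρ * ‖w‖) ^ 2 / (2 * ρ) := by positivity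
  have h3 : (‖p‖ - ρ * ‖w‖) ^ 2 / (2 * ρ) =
      ‖p‖ ^ 2 / (2 * ρ) - ‖p‖ * ‖w‖ + ρ / 2 * ‖w‖ ^ 2 := by
    field_simp; ring
  linarith

section Run

variable {n : ℕ} {F : EuclideanSpace ℝ (Fin n) → ℝ} {ρ β : ℝ}
  {model : ℕ → EuclideanSpace ℝ (Fin n) → ℝ} {x z g : ℕ → EuclideanSpace ℝ (Fin n)}

theorem proxGap_ge (h : IsCutModelRun F ρ β model x z g) (k : ℕ) (y : EuclideanSpace ℝ (Fin n)) :
    F (x k) - F y - ρ / 2 * ‖y - x k‖ ^ 2 ≤ proxGap F ρ model x z k := by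
  have h1 := h.subproblem k y
  have h2 := h.model_le k y
  unfold proxGap
  linarith

theorem proxGap_nonneg (h : IsCutModelRun F ρ β model x z g) (k : ℕ) :
    0 ≤ proxGap F ρ model x z k := by
  simpa using proxGap_ge h k (x k)

theorem dist_sq_le_proxGap (h : IsCutModelRun F ρ β model x z g) (k : ℕ) :
    ρ / 2 * ‖z (k + 1) - x k‖ ^ 2 ≤ proxGap F ρ model x z k := by
  have h1 := h.subgradient_model k (x k)
  have h2 := h.model_le k (x k)
  rw [real_inner_smul_left, real_inner_self_eq_norm_sq, norm_sub_rev] at h1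
  unfold proxGap
  linarith

theorem proxGap_le_decrease (hρ : 0 < ρ) (k : ℕ) :
    proxGap F ρ model x z k ≤ F (x k) - model k (z (k + 1)) := by
  have : 0 ≤ ρ / 2 * ‖z (k + 1) - x k‖ ^ 2 := by positivity
  unfold proxGap
  linarith

theorem proxGap_le_of_cut (hρ : 0 < ρ) (h : IsCutModelRun F ρ β model x z g) (k : ℕ) :
    proxGap F ρ model x z k ≤ F (x k) - cut F z g k (x k) + ‖g k‖ ^ 2 / (2 * ρ) := by
  have h1 := h.cut_le k (z (k + 1))
  rw [cut_eq k _ (x k)] at h1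
  have h2 := neg_sq_le_inner_add_sq hρ (g k) (z (k + 1) - x k)
  unfold proxGap
  linarith

theorem norm_step_eq (hρ : 0 < ρ) (k : ℕ) :
    ‖ρ • (x k - z (k + 1))‖ = ρ * ‖z (k + 1) - x k‖ := by
  rw [norm_smul, Real.norm_of_nonneg hρ.le, norm_sub_rev]

/-- The improvement in the subproblem caused by the new cut and the old linearization. -/
theorem proxGap_succ_le (hρ : 0 < ρ) (h : IsCutModelRun F ρ β model x z g) {k : ℕ}
    (hx : x (k + 1) = x k)
    (hlin : ∀ y, model k (z (k + 1)) + inner ℝ (ρ • (x k - z (k + 1))) (y - z (k + 1)) ≤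
      model (k + 1) y) {μ : ℝ} (h0 : 0 ≤ μ) (h1 : μ ≤ 1) :
    proxGap F ρ model x z (k + 1) ≤ proxGap F ρ model x z k -
      μ * (F (z (k + 1)) - model k (z (k + 1))) +
        μ ^ 2 * ‖g (k + 1) - ρ • (x k - z (k + 1))‖ ^ 2 / (2 * ρ) := by
  set s := ρ • (x k - z (k + 1)) with hs
  set w := z (k + 2) - z (k + 1) with hw
  have h2 := hlin (z (k + 2))
  have h3 := h.cut_le (k + 1) (z (k + 2))
  rw [cut_eq (k + 1) _ (z (k + 1)), cut_self] at h3
  -- Against the old linearization, the average with weight μ on the new cut has its slope changed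
  -- by μ(g - s). The proximal term limits the resulting loss to μ²‖g - s‖²/(2ρ).
  have h4 := neg_sq_le_inner_add_sq hρ (μ • (g (k + 1) - s)) w
  rw [norm_smul, mul_pow, Real.norm_of_nonneg h0, real_inner_smul_left, inner_sub_left] at h4
  have h5 : ‖z (k + 2) - x k‖ ^ 2 * (ρ / 2) =
      ρ / 2 * ‖z (k + 1) - x k‖ ^ 2 - inner ℝ s w + ρ / 2 * ‖w‖ ^ 2 := by
    have : z (k + 2) - x k = (z (k + 1) - x k) + w := by rw [hw]; abel
    rw [this, norm_add_sq_real, hs, real_inner_smul_left, ← neg_sub (z (k + 1)) (x k),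
      inner_neg_left]
    ring
  have h6 : (1 - μ) * (model k (z (k + 1)) + inner ℝ s w) +
      μ * (F (z (k + 1)) + inner ℝ (g (k + 1)) w) ≤ model (k + 1) (z (k + 2)) := by
    have := mul_le_mul_of_nonneg_left h2 (sub_nonneg.2 h1)
    have := mul_le_mul_of_nonneg_left h3 h0
    linarith
  simp only [proxGap, hx, show k + 1 + 1 = k + 2 from rfl] at *
  linarith

theorem value_antitone (hρ : 0 < ρ) (hβ0 : 0 < β) (h : IsCutModelRun F ρ β model x z g) :
    Antitone fun k => F (x k) := by
  refine antitone_nat_of_succ_le fun k => ?_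
  by_cases hk : IsNullStep F β model x z k
  · rw [h.null_step k hk]
  · have hk' := not_not.1 hk
    rw [h.descent_step k hk']
    have := mul_nonneg hβ0.le ((proxGap_nonneg h k).trans (proxGap_le_decrease hρ k))
    linarith

theorem exists_center_eq (h : IsCutModelRun F ρ β model x z g) (k : ℕ) : ∃ j, x k = z j := by
  induction k with
  | zero => exact ⟨0, h.init.symm⟩
  | succ k ih =>
    by_cases hk : IsNullStep F β model x z k
    · rw [h.null_step k hk]; exact ih
    · exact ⟨k + 1, h.descent_step k (not_not.1 hk)⟩

/-! ### Boundedness of centers, trial points and subgradients. -/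

variable {xs : EuclideanSpace ℝ (Fin n)}

/-- An exact proximal step moves towards x*. Here the model replaces F, and the descent test bounds
the error F(z) - model(z) by (1 - β)/β times the decrease of F; the weight of the second term is
chosen so that this error telescopes. -/
theorem lyapunov_succ_le (hρ : 0 < ρ) (hβ0 : 0 < β)
    (h : IsCutModelRun F ρ β model x z g) (hxs : ∀ y, F xs ≤ F y) (k : ℕ) :
    ‖x (k + 1) - xs‖ ^ 2 + 2 / ρ * ((1 - β) / β) * (F (x (k + 1)) - F xs) ≤
      ‖x k - xs‖ ^ 2 + 2 / ρ * ((1 - β) / β) * (F (x k) - F xs) := by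
  by_cases hk : IsNullStep F β model x z k
  · rw [h.null_step k hk]
  have hk' := not_not.1 hk
  rw [h.descent_step k hk']
  have h1 := h.subgradient_model k xs
  have h2 := h.model_le k xs
  rw [real_inner_smul_left] at h1
  have h3 : ‖x k - xs‖ ^ 2 = ‖x k - z (k + 1)‖ ^ 2 - 2 * inner ℝ (x k - z (k + 1))
      (xs - z (k + 1)) + ‖z (k + 1) - xs‖ ^ 2 := by
    have : x k - xs = (x k - z (k + 1)) - (xs - z (k + 1)) := by abel
    rw [this, norm_sub_sq_real, norm_sub_rev xs]
  have h4 : inner ℝ (x k - z (k + 1)) (xs - z (k + 1)) ≤ (F xs - model k (z (k + 1))) / ρ := by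
    rw [le_div_iff₀ hρ]; linarith
  have h5 : F (x k) - model k (z (k + 1)) ≤ (F (x k) - F (z (k + 1))) / β := by
    rw [le_div_iff₀ hβ0]; linarith
  have h6 : (F xs - model k (z (k + 1))) / ρ ≤
      1 / ρ * ((F (x k) - F (z (k + 1))) / β - (F (x k) - F xs)) := by
    rw [div_eq_inv_mul, one_div]
    exact mul_le_mul_of_nonneg_left (by linarith) (inv_pos.2 hρ).le
  have h7 : 1 / ρ * ((F (x k) - F (z (k + 1))) / β - (F (x k) - F xs)) =
      1 / ρ * ((1 - β) / β) * (F (x k) - F xs) - 1 / ρ * ((1 - β) / β) * (F (z (k + 1)) - F xs)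
        - 1 / ρ * (F (z (k + 1)) - F xs) := by
    field_simp; ring
  have h8 : 0 ≤ 1 / ρ * (F (z (k + 1)) - F xs) :=
    mul_nonneg (by positivity) (sub_nonneg.2 (hxs _))
  have h9 : 0 ≤ ‖x k - z (k + 1)‖ ^ 2 := by positivity
  have e : 2 / ρ = 2 * (1 / ρ) := by ring
  rw [e]
  linarith

theorem dist_center_sq_le (hρ : 0 < ρ) (hβ0 : 0 < β) (hβ1 : β < 1)
    (h : IsCutModelRun F ρ β model x z g) (hxs : ∀ y, F xs ≤ F y) (k : ℕ) :
    ‖x k - xs‖ ^ 2 ≤ ‖x 0 - xs‖ ^ 2 + 2 / ρ * ((1 - β) / β) * (F (x 0) - F xs) := by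
  have h1 : Antitone fun k => ‖x k - xs‖ ^ 2 + 2 / ρ * ((1 - β) / β) * (F (x k) - F xs) :=
    antitone_nat_of_succ_le (lyapunov_succ_le hρ hβ0 h hxs)
  have h2 := h1 (Nat.zero_le k)
  have h3 : 0 ≤ 2 / ρ * ((1 - β) / β) * (F (x k) - F xs) := by
    have := sub_nonneg.2 hβ1.le
    have := sub_nonneg.2 (hxs (x k))
    positivity
  simp only at h2
  linarith

/-- The subgradients of a convex function that attains its minimum are bounded on bounded sets. -/
theorem exists_subgradient_bound (hF : ConvexOn ℝ Set.univ F) (hxs : ∀ y, F xs ≤ F y) (r : ℝ) :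
    ∃ G, 0 ≤ G ∧ ∀ w v, IsSubgradient F w v → ‖w - xs‖ ≤ r → ‖v‖ ≤ G := by
  have hc : ContinuousOn F (Metric.closedBall xs (r + 1)) :=
    (hF.continuousOn isOpen_univ).mono (Set.subset_univ _)
  obtain ⟨M, hM⟩ := (isCompact_closedBall xs (r + 1)).bddAbove_image hc
  refine ⟨max 0 (M - F xs), le_max_left _ _, fun w v hv hw => ?_⟩
  rcases eq_or_ne v 0 with rfl | hne
  · simp
  have hv0 : 0 < ‖v‖ := norm_pos_iff.2 hne
  have h1 := hv (w + ‖v‖⁻¹ • v)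
  rw [add_sub_cancel_left, inner_smul_right, real_inner_self_eq_norm_sq, sq,
    inv_mul_cancel_left₀ hv0.ne'] at h1
  have h2 : F (w + ‖v‖⁻¹ • v) ≤ M := by
    refine hM ⟨_, ?_, rfl⟩
    rw [mem_closedBall_iff_norm]
    have : w + ‖v‖⁻¹ • v - xs = (w - xs) + ‖v‖⁻¹ • v := by abel
    rw [this]
    refine (norm_add_le _ _).trans ?_
    rw [norm_smul, norm_inv, norm_norm, inv_mul_cancel₀ hv0.ne']
    linarith
  exact le_max_of_le_right (by linarith [hxs w])

theorem dist_trial_le (hρ : 0 < ρ) (h : IsCutModelRun F ρ β model x z g) {k : ℕ} {X H : ℝ}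
    (hX : ‖x k - xs‖ ≤ X) (hH : proxGap F ρ model x z k ≤ H) :
    ‖z (k + 1) - x k‖ ≤ Real.sqrt (2 * H / ρ) ∧ ‖z (k + 1) - xs‖ ≤ X + Real.sqrt (2 * H / ρ) := by
  have h1 : ‖z (k + 1) - x k‖ ≤ Real.sqrt (2 * H / ρ) := by
    apply Real.le_sqrt_of_sq_le
    rw [le_div_iff₀ hρ]
    linarith [dist_sq_le_proxGap h k]
  refine ⟨h1, ?_⟩
  have : z (k + 1) - xs = (z (k + 1) - x k) + (x k - xs) := by abel
  rw [this]
  exact (norm_add_le _ _).trans (by linarith)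

theorem proxGap_le_of_center (hρ : 0 < ρ) (h : IsCutModelRun F ρ β model x z g) {k : ℕ} {G : ℝ}
    (hk : x k = z k) (hG : ‖g k‖ ≤ G) : proxGap F ρ model x z k ≤ G ^ 2 / (2 * ρ) := by
  have h1 := proxGap_le_of_cut hρ h k
  rw [hk, cut_self, sub_self, zero_add] at h1
  refine h1.trans ?_
  gcongr

/-- A bound on δ_k is needed to bound the trial points, so L cannot be used yet. Right after a
descent step (or at the start) the cut at the center bounds δ by H₀. After the first null step, the
trial point is within a known distance and its subgradient is bounded, giving H₁. Further null steps
do not increase δ. -/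
theorem exists_proxGap_bound (hρ : 0 < ρ) (hβ0 : 0 < β)
    (hF : ConvexOn ℝ Set.univ F)
    (h : IsCutModelRun F ρ β model x z g) (hxs : ∀ y, F xs ≤ F y) {X : ℝ}
    (hX : ∀ k, ‖x k - xs‖ ≤ X) : ∃ H, ∀ k, proxGap F ρ model x z k ≤ H := by
  obtain ⟨G₀, -, hG₀⟩ := exists_subgradient_bound hF hxs X
  set H₀ := G₀ ^ 2 / (2 * ρ) with hH₀
  obtain ⟨G₁, hG₁0, hG₁⟩ := exists_subgradient_bound hF hxs (X + Real.sqrt (2 * H₀ / ρ))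
  set H₁ := F (x 0) - F xs + G₁ * Real.sqrt (2 * H₀ / ρ) + G₁ ^ 2 / (2 * ρ) with hH₁
  have hcenter : ∀ k, x k = z k → proxGap F ρ model x z k ≤ H₀ := fun k hk =>
    proxGap_le_of_center hρ h hk (hG₀ _ _ (h.subgradient k) (hk ▸ hX k))
  have hfresh : ∀ k, proxGap F ρ model x z k ≤ H₀ → IsNullStep F β model x z k →
      proxGap F ρ model x z (k + 1) ≤ H₁ := by
    intro k hk hnull
    obtain ⟨h1, h2⟩ := dist_trial_le hρ h (hX k) hk
    have h3 := hG₁ _ _ (h.subgradient (k + 1)) h2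
    have h4 := proxGap_le_of_cut hρ h (k + 1)
    rw [h.null_step k hnull, cut] at h4
    have h5 := (abs_le.1 (abs_real_inner_le_norm (g (k + 1)) (x k - z (k + 1)))).1
    rw [norm_sub_rev] at h5
    have h6 : ‖g (k + 1)‖ * ‖z (k + 1) - x k‖ ≤ G₁ * Real.sqrt (2 * H₀ / ρ) := by gcongr
    have h7 : ‖g (k + 1)‖ ^ 2 / (2 * ρ) ≤ G₁ ^ 2 / (2 * ρ) := by gcongr
    have h8 := value_antitone hρ hβ0 h (Nat.zero_le k)
    have h9 := hxs (z (k + 1))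
    simp only at h8
    linarith
  have hall : ∀ k, proxGap F ρ model x z k ≤ H₀ ∨
      (∃ j, k = j + 1 ∧ IsNullStep F β model x z j ∧ proxGap F ρ model x z k ≤ H₁) := by
    intro k
    induction k with
    | zero => exact Or.inl (hcenter 0 h.init.symm)
    | succ k ih =>
      by_cases hk : IsNullStep F β model x z k
      · refine Or.inr ⟨k, rfl, hk, ?_⟩
        rcases ih with ih | ⟨j, rfl, hj, ih⟩
        · exact hfresh k ih hk
        -- Weight μ = 0: the surviving linearization alone shows that δ does not increase.
        · refine (proxGap_succ_le hρ h (h.null_step _ hk)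
            (fun y => h.linearization_le j y hj hk) le_rfl zero_le_one).trans ?_
          simpa using ih
      · exact Or.inl (hcenter _ (h.descent_step k (not_not.1 hk)))
  refine ⟨max H₀ H₁, fun k => ?_⟩
  rcases hall k with hk | ⟨-, -, -, hk⟩
  · exact le_max_of_le_left hk
  · exact le_max_of_le_right hk

theorem bddAbove_norm_subgradient (hρ : 0 < ρ) (hβ0 : 0 < β) (hβ1 : β < 1)
    (hF : ConvexOn ℝ Set.univ F)
    (h : IsCutModelRun F ρ β model x z g) (hxs : ∀ y, F xs ≤ F y) :
    BddAbove (Set.range fun k => ‖g k‖) := by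
  have hX : ∀ k, ‖x k - xs‖ ≤ _ :=
    fun k => Real.le_sqrt_of_sq_le (dist_center_sq_le hρ hβ0 hβ1 h hxs k)
  obtain ⟨H, hH⟩ := exists_proxGap_bound hρ hβ0 hF h hxs hX
  obtain ⟨G, -, hG⟩ := exists_subgradient_bound hF hxs
    (Real.sqrt (‖x 0 - xs‖ ^ 2 + 2 / ρ * ((1 - β) / β) * (F (x 0) - F xs)) +
      Real.sqrt (2 * H / ρ))
  refine ⟨G, ?_⟩
  rintro _ ⟨k, rfl⟩
  refine hG _ _ (h.subgradient k) ?_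
  cases k with
  | zero =>
    rw [h.init]
    exact (hX 0).trans (le_add_of_nonneg_right (Real.sqrt_nonneg _))
  | succ k => exact (dist_trial_le hρ h (hX k) (hH k)).2

theorem initial_gap_le (h : IsCutModelRun F ρ β model x z g) {L : ℝ} (hL : ∀ k, ‖g k‖ ≤ L) :
    F (x 0) - F xs ≤ L * ‖x 0 - xs‖ := by
  have h1 := h.subgradient 0 xs
  rw [h.init] at h1
  have h2 := (abs_le.1 (abs_real_inner_le_norm (g 0) (xs - x 0))).1
  rw [norm_sub_rev] at h2
  have h3 := mul_le_mul_of_nonneg_right (hL 0) (norm_nonneg (x 0 - xs))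
  linarith

theorem initial_gap_le' (hρ : 0 < ρ) (h : IsCutModelRun F ρ β model x z g) {L : ℝ}
    (hL : ∀ k, ‖g k‖ ≤ L) :
    F (x 0) - F xs ≤ ρ / 2 * (‖x 0 - xs‖ ^ 2 + L ^ 2 / ρ ^ 2) := by
  refine (initial_gap_le h hL).trans ?_
  have h1 : 0 ≤ (ρ * ‖x 0 - xs‖ - L) ^ 2 / (2 * ρ) := by positivity
  have h2 : (ρ * ‖x 0 - xs‖ - L) ^ 2 / (2 * ρ) =
      ρ / 2 * (‖x 0 - xs‖ ^ 2 + L ^ 2 / ρ ^ 2) - L * ‖x 0 - xs‖ := by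
    field_simp; ring
  linarith

/-- The step length is at most L/ρ since ρ(x_k - z_{k+1}) is bounded by L. The Lyapunov bound
controls the center, with the initial gap at most (ρ/2)(R² + L²/ρ²), and ‖u + v‖² ≤ 2‖u‖² + 2‖v‖²
combines the two. -/
theorem dist_trial_le_distanceBound (hρ : 0 < ρ) (hβ0 : 0 < β) (hβ1 : β < 1)
    (h : IsCutModelRun F ρ β model x z g) (hxs : ∀ y, F xs ≤ F y) {L : ℝ}
    (hL : ∀ k, ‖g k‖ ≤ L) (k : ℕ) : ‖z k - xs‖ ≤ distanceBound ρ β L ‖x 0 - xs‖ := by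
  apply Real.le_sqrt_of_sq_le
  set S := ‖x 0 - xs‖ ^ 2 + L ^ 2 / ρ ^ 2 with hS
  have hκ : 0 ≤ (1 - β) / β := div_nonneg (by linarith) hβ0.le
  have hLρ : 0 ≤ L ^ 2 / ρ ^ 2 := by positivity
  have hS0 : 0 ≤ S := by positivity
  cases k with
  | zero =>
    rw [h.init]
    nlinarith [mul_nonneg hκ hS0]
  | succ k =>
    have h1 := dist_center_sq_le hρ hβ0 hβ1 h hxs k
    have h2 : 2 / ρ * ((1 - β) / β) * (F (x 0) - F xs) ≤ (1 - β) / β * S := by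
      have h3 := mul_le_mul_of_nonneg_left (initial_gap_le' (xs := xs) hρ h hL)
        (show 0 ≤ 2 / ρ * ((1 - β) / β) by positivity)
      rw [← hS] at h3
      refine h3.trans_eq ?_
      field_simp
    have h4 : ‖z (k + 1) - x k‖ ^ 2 ≤ L ^ 2 / ρ ^ 2 := by
      have h5 := h.norm_le L hL k
      rw [norm_step_eq hρ] at h5
      rw [← div_pow]
      gcongr
      rw [le_div_iff₀ hρ]
      linarith
    have h6 : ‖z (k + 1) - xs‖ ^ 2 ≤ 2 * ‖z (k + 1) - x k‖ ^ 2 + 2 * ‖x k - xs‖ ^ 2 := by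
      have h7 := norm_add_le (z (k + 1) - x k) (x k - xs)
      rw [sub_add_sub_cancel] at h7
      nlinarith [sq_nonneg (‖z (k + 1) - x k‖ - ‖x k - xs‖), norm_nonneg (z (k + 1) - xs)]
    nlinarith

end Run

/-! ### Counting the iterations. -/

theorem seventeen_div_four_le_log : 17 / 4 ≤ Real.log 72 := by
  have h1 : Real.exp 17 ≤ 72 ^ 4 := by
    have : Real.exp 17 = Real.exp 1 ^ 17 := by rw [← Real.exp_nat_mul]; norm_num
    rw [this]
    calc Real.exp 1 ^ 17 ≤ 2.7182818286 ^ 17 := by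
          gcongr
          exact Real.exp_one_lt_d9.le
      _ ≤ 72 ^ 4 := by norm_num
  have h2 := (Real.le_log_iff_exp_le (by norm_num)).2 h1
  rw [Real.log_pow] at h2
  push_cast at h2
  linarith

/-- The left side is the count of `index_le` with b = βa and l = ln(gap/ε); the right side is B - 1.
The value 9/(2b²) is at least 72 when b ≤ 1/4, which is the source of the constant 17/4. -/
theorem iteration_count_le {N b l q : ℝ} (hb0 : 0 < b) (hb : b ≤ 1 / 4) (hN : 8 ≤ N) (hl : 0 ≤ l)
    (hq : -1 ≤ q) : (2 * N + 2) * (2 / b) * l + 1 + 2 * N ≤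
      N * q + (l + Real.log (1 / b)) * (N / b * Real.log (9 / (2 * b ^ 2)) + 2 / b) + 1 := by
  have h1 : 17 / 4 ≤ Real.log (9 / (2 * b ^ 2)) := by
    refine seventeen_div_four_le_log.trans (Real.log_le_log (by norm_num) ?_)
    rw [le_div_iff₀ (by positivity)]
    nlinarith
  have h2 : 3 / 4 ≤ Real.log (1 / b) := by
    have := Real.one_sub_inv_le_log_of_pos (x := 1 / b) (by positivity)
    rw [one_div, inv_inv] at this
    rw [one_div]
    linarith
  have hb' : 4 ≤ 1 / b := by rw [le_div_iff₀ hb0]; linarith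
  set Λ := Real.log (9 / (2 * b ^ 2))
  set c := 1 / b with hc
  rw [show N / b = N * c by rw [hc]; ring, show 2 / b = 2 * c by rw [hc]; ring]
  have hNc : 0 ≤ N * c := by positivity
  have h3 : N * c * (17 / 4) + 2 * c ≤ N * c * Λ + 2 * c := by
    linarith [mul_le_mul_of_nonneg_left h1 hNc]
  have h4 : (l + 3 / 4) * (N * c * (17 / 4) + 2 * c) ≤
      (l + Real.log c) * (N * c * Λ + 2 * c) := by
    gcongr
  have h5 : 0 ≤ c * l * (N - 8) := by
    have := sub_nonneg.2 hN
    positivity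
  have h6 : 4 * N ≤ N * c := by nlinarith
  have h7 : -N ≤ N * q := by nlinarith
  nlinarith

section Run

variable {n : ℕ} {F : EuclideanSpace ℝ (Fin n) → ℝ} {ρ β : ℝ}
  {model : ℕ → EuclideanSpace ℝ (Fin n) → ℝ} {x z g : ℕ → EuclideanSpace ℝ (Fin n)}
  {xs : EuclideanSpace ℝ (Fin n)} {L : ℝ}

/-- After a null step, F(x_k) minus the new cut at x_k is at most 2L times the step length L/ρ, that
is 4 · L²/(2ρ); the new cut's own slope adds one more L²/(2ρ). The center is an earlier trial point,
so a subgradient of norm at most L is available there. -/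
theorem proxGap_le (hρ : 0 < ρ) (h : IsCutModelRun F ρ β model x z g) (hL : ∀ k, ‖g k‖ ≤ L)
    (k : ℕ) : proxGap F ρ model x z k ≤ 5 * (L ^ 2 / (2 * ρ)) := by
  have hcenter : ∀ k, x k = z k → proxGap F ρ model x z k ≤ 5 * (L ^ 2 / (2 * ρ)) := by
    intro k hk
    have h1 := proxGap_le_of_center hρ h hk (hL k)
    have : 0 ≤ L ^ 2 / (2 * ρ) := by positivity
    linarith
  cases k with
  | zero => exact hcenter 0 h.init.symm
  | succ k =>
    by_cases hk : IsNullStep F β model x z k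
    · have h1 := proxGap_le_of_cut hρ h (k + 1)
      rw [h.null_step k hk, cut] at h1
      obtain ⟨j, hj⟩ := exists_center_eq h k
      have h2 := h.subgradient j (z (k + 1))
      rw [← hj] at h2
      have h3 := (abs_le.1 (abs_real_inner_le_norm (g j) (z (k + 1) - x k))).1
      have h4 := (abs_le.1 (abs_real_inner_le_norm (g (k + 1)) (x k - z (k + 1)))).1
      rw [norm_sub_rev] at h4
      have h5 : ‖z (k + 1) - x k‖ ≤ L / ρ := by
        rw [le_div_iff₀ hρ, mul_comm, ← norm_step_eq hρ]
        exact h.norm_le L hL k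
      have hL0 : 0 ≤ L := (norm_nonneg _).trans (hL 0)
      have h6 : ∀ i, ‖g i‖ * ‖z (k + 1) - x k‖ ≤ L * (L / ρ) := fun i => by
        have := hL i
        gcongr
      have h7 : ‖g (k + 1)‖ ^ 2 / (2 * ρ) ≤ L ^ 2 / (2 * ρ) := by
        have := hL (k + 1)
        gcongr
      have h8 : L * (L / ρ) = 2 * (L ^ 2 / (2 * ρ)) := by field_simp
      have h9 := h6 j
      have h10 := h6 (k + 1)
      linarith
    · exact hcenter _ (h.descent_step k (not_not.1 hk))

theorem proxGap_null_step_le (hρ : 0 < ρ) (hβ0 : 0 < β) (hβ1 : β < 1)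
    (h : IsCutModelRun F ρ β model x z g) (hL : ∀ k, ‖g k‖ ≤ L) (hL0 : 0 < L) {k : ℕ}
    (hk : IsNullStep F β model x z k) (hk1 : IsNullStep F β model x z (k + 1)) :
    proxGap F ρ model x z (k + 2) ≤ proxGap F ρ model x z (k + 1) -
      ρ * (1 - β) ^ 2 / (8 * L ^ 2) * proxGap F ρ model x z (k + 1) ^ 2 := by
  set δ := proxGap F ρ model x z (k + 1) with hδ
  have hδ0 : 0 ≤ δ := proxGap_nonneg h _
  have hβ : 0 < 1 - β := sub_pos.2 hβ1
  -- Minimizer of -μ(1 - β)δ + μ²(2L)²/(2ρ); the bound of `proxGap_le` keeps it below 1.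
  set μ := ρ * (1 - β) * δ / (4 * L ^ 2) with hμ
  have hμ0 : 0 ≤ μ := by positivity
  have hμ1 : μ ≤ 1 := by
    rw [hμ, div_le_one (by positivity)]
    have h1 := proxGap_le hρ h hL (k + 1)
    have h2 : 5 * (L ^ 2 / (2 * ρ)) * ρ = 5 / 2 * L ^ 2 := by field_simp
    have h3 : ρ * (1 - β) * δ ≤ ρ * 1 * δ := by gcongr; linarith
    nlinarith [mul_le_mul_of_nonneg_right h1 hρ.le]
  have h1 := proxGap_succ_le hρ h (h.null_step _ hk1)
    (fun y => h.linearization_le k y hk hk1) hμ0 hμ1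
  have h2 : (1 - β) * δ ≤ F (z (k + 2)) - model (k + 1) (z (k + 2)) := by
    have h3 := not_le.1 hk1
    have h4 := proxGap_le_decrease (F := F) (model := model) (x := x) (z := z) hρ (k + 1)
    have h5 := mul_le_mul_of_nonneg_left h4 hβ.le
    simp only [show k + 1 + 1 = k + 2 from rfl] at *
    linarith
  have h3 : ‖g (k + 2) - ρ • (x (k + 1) - z (k + 2))‖ ^ 2 ≤ (2 * L) ^ 2 := by
    gcongr
    refine (norm_sub_le _ _).trans ?_
    linarith [hL (k + 2), h.norm_le L hL (k + 1)]
  have h4 : μ ^ 2 * ‖g (k + 2) - ρ • (x (k + 1) - z (k + 2))‖ ^ 2 / (2 * ρ) ≤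
      μ ^ 2 * (2 * L) ^ 2 / (2 * ρ) := by gcongr
  have h5 := mul_le_mul_of_nonneg_left h2 hμ0
  have h6 : μ ^ 2 * (2 * L) ^ 2 / (2 * ρ) - μ * ((1 - β) * δ) =
      -(ρ * (1 - β) ^ 2 / (8 * L ^ 2) * δ ^ 2) := by
    rw [hμ]; field_simp; ring
  simp only [show k + 1 + 1 = k + 2 from rfl] at *
  linarith

theorem inv_add_le_inv {c u v : ℝ} (hc : 0 < c) (hv : 0 < v) (hu : 0 < u)
    (h : v ≤ u - c * u ^ 2) : 1 / (c * u) + 1 ≤ 1 / (c * v) := by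
  have h1 : 1 / (c * u) + 1 = (1 + c * u) / (c * u) := by field_simp
  rw [h1, div_le_div_iff₀ (by positivity) (by positivity)]
  have h2 : (1 + c * u) * v ≤ (1 + c * u) * (u - c * u ^ 2) := by gcongr
  have h3 : (1 + c * u) * (u - c * u ^ 2) = u - c ^ 2 * u ^ 3 := by ring
  have h4 : 0 ≤ c ^ 2 * u ^ 3 := by positivity
  nlinarith

theorem proxGap_ge_of_dist (hρ : 0 < ρ) (hF : ConvexOn ℝ Set.univ F)
    (h : IsCutModelRun F ρ β model x z g) {a D : ℝ} (ha0 : 0 ≤ a) (ha1 : a ≤ 1) {k : ℕ}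
    (hD : ‖x k - xs‖ ≤ D) :
    a * (F (x k) - F xs) - ρ / 2 * (a ^ 2 * D ^ 2) ≤ proxGap F ρ model x z k := by
  have h1 := proxGap_ge h k (x k + a • (xs - x k))
  rw [add_sub_cancel_left, norm_smul, mul_pow, Real.norm_of_nonneg ha0, norm_sub_rev] at h1
  have h2 := hF.2 (Set.mem_univ (x k)) (Set.mem_univ xs) (sub_nonneg.2 ha1) ha0 (by ring)
  have h3 : (1 - a) • x k + a • xs = x k + a • (xs - x k) := by module
  rw [h3, smul_eq_mul, smul_eq_mul] at h2
  have h4 : ρ / 2 * (a ^ 2 * ‖x k - xs‖ ^ 2) ≤ ρ / 2 * (a ^ 2 * D ^ 2) := by gcongr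
  linarith

theorem log_descent_step {u v b : ℝ} (hv : 0 < v) (hu : 0 < u) (h : v ≤ u - b * u) :
    Real.log v + b ≤ Real.log u := by
  have h1 : v ≤ Real.exp (-b) * u := by
    nlinarith [Real.add_one_le_exp (-b)]
  have h2 := Real.log_le_log hv h1
  rw [Real.log_mul (Real.exp_ne_zero _) hu.ne', Real.log_exp] at h2
  linarith

/-- Amortized count: the logarithmic decrease of the objective gap pays for the descent steps and
for the null steps between them, and 1/(cδ) measures progress within a run of null steps. -/
theorem index_le (hρ : 0 < ρ) (hβ0 : 0 < β) (hβ1 : β < 1)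
    (h : IsCutModelRun F ρ β model x z g) (hL : ∀ k, ‖g k‖ ≤ L) (hL0 : 0 < L)
    {a ε c : ℝ} (ha : 0 < a) (hε : 0 < ε) (hc : c = ρ * (1 - β) ^ 2 / (8 * L ^ 2)) {K : ℕ}
    (hgap : ∀ k ≤ K, ε < F (x k) - F xs)
    (hδ : ∀ k ≤ K, a / 2 * (F (x k) - F xs) ≤ proxGap F ρ model x z k) :
    (K : ℝ) ≤ (2 * (1 / (c * a * ε)) + 2) * (2 / (β * a)) *
      Real.log ((F (x 0) - F xs) / ε) + 1 + 2 * (1 / (c * a * ε)) := by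
  have hc0 : 0 < c := by
    rw [hc]
    have := sub_pos.2 hβ1
    positivity
  set N := 1 / (c * a * ε) with hN
  -- A descent step raises ℓ by at least βa/2, so it earns 2N + 2: this covers 1/(cδ) ≤ 2N, the
  -- first null step of the run, and the descent step itself.
  set A := (2 * N + 2) * (2 / (β * a)) with hA
  have hN0 : 0 < N := by positivity
  have hA0 : 0 < A := by positivity
  have hgap0 : ∀ k ≤ K, 0 < F (x k) - F xs := fun k hk => hε.trans (hgap k hk)
  have hδε : ∀ k ≤ K, a * ε / 2 ≤ proxGap F ρ model x z k := by
    intro k hk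
    have := mul_le_mul_of_nonneg_left (hgap k hk).le (half_pos ha).le
    linarith [hδ k hk]
  have hδ0 : ∀ k ≤ K, 0 < proxGap F ρ model x z k :=
    fun k hk => lt_of_lt_of_le (by positivity) (hδε k hk)
  have hδN : ∀ k ≤ K, 1 / (c * proxGap F ρ model x z k) ≤ 2 * N := by
    intro k hk
    rw [show 2 * N = 1 / (c * (a * ε / 2)) by rw [hN]; field_simp]
    have := hδε k hk
    gcongr
  set ℓ : ℕ → ℝ := fun k => Real.log (F (x 0) - F xs) - Real.log (F (x k) - F xs) with hℓ
  -- The extra 1 pays for the first null step of a run, for which no decrease of δ is available.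
  have main : ∀ k ≤ K, (k : ℝ) ≤ A * ℓ k ∨ (∃ j, k = j + 1 ∧ IsNullStep F β model x z j ∧
      (k : ℝ) ≤ A * ℓ k + 1 + 1 / (c * proxGap F ρ model x z k)) := by
    intro k
    induction k with
    | zero => intro _; exact Or.inl (by simp [hℓ])
    | succ k ih =>
      intro hk
      have hkK : k ≤ K := (Nat.le_succ k).trans hk
      specialize ih hkK
      rw [Nat.cast_succ]
      by_cases hnull : IsNullStep F β model x z k
      · refine Or.inr ⟨k, rfl, hnull, ?_⟩
        have hx := h.null_step k hnull
        have hℓk : ℓ (k + 1) = ℓ k := by simp only [hℓ, hx]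
        rw [hℓk]
        rcases ih with ih | ⟨j, rfl, hj, ih⟩
        · have : 0 < 1 / (c * proxGap F ρ model x z (k + 1)) := by
            have := hδ0 _ hk
            positivity
          linarith
        · have h1 := proxGap_null_step_le hρ hβ0 hβ1 h hL hL0 hj hnull
          rw [← hc] at h1
          have h2 := inv_add_le_inv hc0 (hδ0 _ hk) (hδ0 _ hkK) h1
          simp only [show j + 1 + 1 = j + 2 from rfl] at *
          linarith
      · left
        have h1 := not_not.1 hnull
        have h2 : F (x (k + 1)) - F xs ≤
            (F (x k) - F xs) - β * a / 2 * (F (x k) - F xs) := by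
          rw [h.descent_step k h1]
          have h3 := (hδ k hkK).trans
            (proxGap_le_decrease (F := F) (model := model) (x := x) (z := z) hρ k)
          have h4 := mul_le_mul_of_nonneg_left h3 hβ0.le
          linarith
        have h3 := log_descent_step (hgap0 _ hk) (hgap0 _ hkK) h2
        have h4 : A * (ℓ k + β * a / 2) ≤ A * ℓ (k + 1) := by
          gcongr
          simp only [hℓ]
          linarith
        have h5 : A * (β * a / 2) = 2 * N + 2 := by
          rw [hA]; field_simp
        have h6 : (k : ℝ) ≤ A * ℓ k + 1 + 2 * N := by
          rcases ih with ih | ⟨j, -, -, ih⟩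
          · linarith
          · linarith [hδN k hkK]
        linarith
  have hlog : ℓ K ≤ Real.log ((F (x 0) - F xs) / ε) := by
    rw [Real.log_div (hgap0 0 (Nat.zero_le K)).ne' hε.ne']
    have := Real.log_le_log hε (hgap K le_rfl).le
    simp only [hℓ]
    linarith
  have h1 := mul_le_mul_of_nonneg_left hlog hA0.le
  rcases main K le_rfl with h2 | ⟨-, -, -, h2⟩
  · linarith
  · linarith [hδN K le_rfl]

theorem exists_le_of_small (hρ : 0 < ρ) (hβ0 : 0 < β) (hβ1 : β < 1) (hF : ConvexOn ℝ Set.univ F)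
    (h : IsCutModelRun F ρ β model x z g) (hL : ∀ k, ‖g k‖ ≤ L)
    {D ε : ℝ} (hD : 0 < D) (hzD : ∀ k, ‖z k - xs‖ ≤ D) (hε : 0 < ε) (hεD : ε ≤ ρ * D ^ 2 / 4) :
    ∃ k : ℕ, (k : ℝ) ≤ max 0 (bundleRate ρ β L (F (x 0) - F xs) D ε) ∧
      F (x k) - F xs ≤ ε := by
  by_contra! hcon
  set a := ε / (ρ * D ^ 2) with ha
  have hρD : 0 < ρ * D ^ 2 := by positivity
  have ha0 : 0 < a := by positivity
  have ha4 : a ≤ 1 / 4 := by rw [ha, div_le_iff₀ hρD]; linarith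
  have haD : ρ * D ^ 2 * a = ε := by rw [ha]; field_simp
  have hmin : min 1 (ε / (ρ * D ^ 2)) = a := min_eq_right (by rw [← ha]; linarith)
  have hgap0 : ε < F (x 0) - F xs := hcon 0 (by simp)
  have hβ : 0 < 1 - β := sub_pos.2 hβ1
  have hδ : ∀ k, ε < F (x k) - F xs →
      a / 2 * (F (x k) - F xs) ≤ proxGap F ρ model x z k := by
    intro k hk
    have hx : ‖x k - xs‖ ≤ D := by
      obtain ⟨j, hj⟩ := exists_center_eq h k
      rw [hj]; exact hzD j
    have h1 := proxGap_ge_of_dist hρ hF h ha0.le (by linarith) hx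
    have h2 : ρ / 2 * (a ^ 2 * D ^ 2) = a / 2 * ε := by rw [← haD]; ring
    have h3 := mul_le_mul_of_nonneg_left hk.le (half_pos ha0).le
    linarith
  -- Since z_0 = x_0, the initial proximal gap is at most L²/(2ρ). This yields L > 0, N ≥ 8 and the
  -- lower bound -1 for the first logarithm.
  have hδ0 : a * ε / 2 ≤ L ^ 2 / (2 * ρ) := by
    have h1 := proxGap_le_of_center hρ h h.init.symm (hL 0)
    have h2 := hδ 0 hgap0
    have h3 := mul_le_mul_of_nonneg_left hgap0.le (half_pos ha0).le
    linarith
  have hL0 : 0 < L := by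
    refine lt_of_le_of_ne ((norm_nonneg _).trans (hL 0)) ?_
    rintro rfl
    have : 0 < a * ε / 2 := by positivity
    norm_num at hδ0
    linarith
  set c := ρ * (1 - β) ^ 2 / (8 * L ^ 2) with hc
  have hc0 : 0 < c := by positivity
  set N := 1 / (c * a * ε) with hN
  have hN8 : 8 ≤ N := by
    rw [hN, le_div_iff₀ (by positivity), hc]
    have h1 : ρ * (a * ε) ≤ L ^ 2 := by
      have := mul_le_mul_of_nonneg_right hδ0 (show 0 ≤ 2 * ρ by positivity)
      rw [div_mul_cancel₀ _ (by positivity)] at this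
      linarith
    have h2 : (1 - β) ^ 2 ≤ 1 := by nlinarith
    have h3 : (1 - β) ^ 2 * (ρ * (a * ε)) ≤ 1 * L ^ 2 := by gcongr
    have h4 : 8 * (ρ * (1 - β) ^ 2 / (8 * L ^ 2) * a * ε) =
      (1 - β) ^ 2 * (ρ * (a * ε)) / L ^ 2 := by field_simp
    rw [h4, div_le_one (by positivity)]
    linarith
  set l := Real.log ((F (x 0) - F xs) / ε) with hl
  have hl0 : 0 ≤ l := Real.log_nonneg (by rw [le_div_iff₀ hε]; linarith)
  have hq : -1 ≤ Real.log (L ^ 2 / (2 * ρ * a * ε)) := by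
    have h1 : 1 / 2 ≤ L ^ 2 / (2 * ρ * a * ε) := by
      have h2 : L ^ 2 / (2 * ρ * a * ε) = L ^ 2 / (2 * ρ) / (a * ε) := by field_simp
      rw [h2, le_div_iff₀ (by positivity)]
      linarith
    have h2 := Real.one_sub_inv_le_log_of_pos (x := 1 / 2) (by norm_num)
    have h3 := Real.log_le_log (by norm_num) h1
    norm_num at h2
    linarith
  have hb0 : 0 < β * a := by positivity
  have hb : β * a ≤ 1 / 4 := by nlinarith
  have hcount := iteration_count_le hb0 hb hN8 hl0 hq
  have hB : bundleRate ρ β L (F (x 0) - F xs) D ε =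
      N * Real.log (L ^ 2 / (2 * ρ * a * ε)) + (l + Real.log (1 / (β * a))) *
        (N / (β * a) * Real.log (9 / (2 * (β * a) ^ 2)) + 2 / (β * a)) + 1 + 1 := by
    have hgap : 0 < F (x 0) - F xs := hε.trans hgap0
    have e1 : l + Real.log (1 / (β * a)) = Real.log ((F (x 0) - F xs) / (β * a * ε)) := by
      rw [hl, ← Real.log_mul (by positivity) (by positivity)]
      congr 1
      field_simp
    have e2 : 8 * L ^ 2 / (ρ * (1 - β) ^ 2 * a * ε) = N := by
      rw [hN, hc]; field_simp
    have e3 : 8 * L ^ 2 / (ρ * (1 - β) ^ 2 * β * a ^ 2 * ε) = N / (β * a) := by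
      rw [hN, hc]; field_simp
    have e4 : 9 / (2 * a ^ 2 * β ^ 2) = 9 / (2 * (β * a) ^ 2) := by
      congr 1; ring
    rw [bundleRate, hmin, growthRate, e1, e2, e3, e4]
    ring
  set B := bundleRate ρ β L (F (x 0) - F xs) D ε with hBdef
  have hB0 : 0 ≤ B := by
    have : 0 ≤ (2 * N + 2) * (2 / (β * a)) * l := by positivity
    linarith
  -- With K = ⌊B⌋ the count gives K ≤ B - 1, which contradicts B < K + 1.
  have hfloor : ∀ k ≤ ⌊B⌋₊, ε < F (x k) - F xs := fun k hk =>
    hcon k (le_max_of_le_right ((Nat.cast_le.2 hk).trans (Nat.floor_le hB0)))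
  have hK := index_le hρ hβ0 hβ1 h hL hL0 ha0 hε hc hfloor (fun k hk => hδ k (hfloor k hk))
  have := Nat.lt_floor_add_one B
  linarith

/-- For ε ≥ ρD²/4 the starting point already suffices: D² ≥ 2(R² + L²/ρ²) makes the initial gap at
most ρD²/4. -/
theorem exists_le_of_distanceBound_le (hρ : 0 < ρ) (hβ0 : 0 < β) (hβ1 : β < 1)
    (hF : ConvexOn ℝ Set.univ F)
    (h : IsCutModelRun F ρ β model x z g) (hxs : ∀ y, F xs ≤ F y) (hL : ∀ k, ‖g k‖ ≤ L)
    {D ε : ℝ} (hD : 0 < D) (hDD : distanceBound ρ β L ‖x 0 - xs‖ ≤ D) (hε : 0 < ε) :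
    ∃ k : ℕ, (k : ℝ) ≤ max 0 (bundleRate ρ β L (F (x 0) - F xs) D ε) ∧
      F (x k) - F xs ≤ ε := by
  rcases le_total ε (ρ * D ^ 2 / 4) with hle | hge
  · exact exists_le_of_small hρ hβ0 hβ1 hF h hL hD
      (fun k => (dist_trial_le_distanceBound hρ hβ0 hβ1 h hxs hL k).trans hDD) hε hle
  · refine ⟨0, by simp, ?_⟩
    have h1 := (Real.sqrt_le_left hD.le).1 hDD
    have hS : 0 ≤ ‖x 0 - xs‖ ^ 2 + L ^ 2 / ρ ^ 2 := by positivity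
    have hκ : 0 ≤ (1 - β) / β := div_nonneg (by linarith) hβ0.le
    have h2 := initial_gap_le' (xs := xs) hρ h hL
    have h3 : 2 * (‖x 0 - xs‖ ^ 2 + L ^ 2 / ρ ^ 2) ≤ D ^ 2 := by
      nlinarith [mul_nonneg hκ hS]
    have h4 := mul_le_mul_of_nonneg_left h3 hρ.le
    linarith

end Run

/-! ### Order of magnitude of the bound. -/

/-- Enlarging the bound to (1 + M)(1 + u)^p makes both logarithms nonnegative, so their sum is
absorbed in a product. -/
theorem log_le_mul_one_add_log {y M u : ℝ} {p : ℕ} (hy : 0 ≤ y) (hM : 0 ≤ M) (hu : 0 ≤ u)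
    (h : y ≤ M * u ^ p) :
    Real.log y ≤ (p + Real.log (1 + M)) * (1 + Real.log (1 + u)) := by
  have h1 : 0 ≤ Real.log (1 + M) := Real.log_nonneg (by linarith)
  have h2 : 0 ≤ Real.log (1 + u) := Real.log_nonneg (by linarith)
  have hp : (0 : ℝ) ≤ p := p.cast_nonneg
  rcases hy.eq_or_lt with rfl | hy
  · rw [Real.log_zero]; positivity
  have h3 : y ≤ (1 + M) * (1 + u) ^ p := by
    refine h.trans ?_
    gcongr <;> linarith
  have h4 := Real.log_le_log hy h3
  rw [Real.log_mul (by positivity) (by positivity), Real.log_pow] at h4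
  nlinarith [mul_nonneg h1 h2]

theorem rate_terms_le {N₁ N₂ N₃ q₁ q₂ q₃ c₁ c₂ c₃ c₄ l₁ l₂ l₃ Q T : ℝ} (hN₁ : 0 ≤ N₁)
    (hN₂ : 0 ≤ N₂) (hN₃ : 0 ≤ N₃) (hq₃ : 0 ≤ q₃) (hl₁ : 0 ≤ l₁) (hl₂ : 0 ≤ l₂) (hc₂ : 0 ≤ c₂)
    (hQ : 0 ≤ Q) (hT : 1 ≤ T) (h₁ : N₁ ≤ c₁ * Q) (h₂ : N₂ ≤ c₂ * Q) (h₃ : N₃ ≤ c₃ * Q)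
    (hq₁ : q₁ ≤ l₁ * T) (hq₂ : q₂ ≤ l₂ * T) (hq₃T : q₃ ≤ l₃ * T) (h₄ : 2 ≤ c₄ * Q) :
    N₁ * q₁ + q₂ * (N₂ * q₃ + N₃) + 2 ≤
      (c₁ * l₁ + l₂ * (c₂ * l₃ + c₃) + c₄) * Q * T ^ 2 := by
  have hT0 : 0 ≤ T := zero_le_one.trans hT
  have hTT : T ≤ T ^ 2 := by nlinarith
  have e₁ : N₁ * q₁ ≤ c₁ * l₁ * Q * T ^ 2 := by
    calc N₁ * q₁ ≤ N₁ * (l₁ * T ^ 2) :=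
          mul_le_mul_of_nonneg_left (hq₁.trans (mul_le_mul_of_nonneg_left hTT hl₁)) hN₁
      _ ≤ c₁ * Q * (l₁ * T ^ 2) := mul_le_mul_of_nonneg_right h₁ (by positivity)
      _ = _ := by ring
  have e₂ : N₂ * q₃ + N₃ ≤ (c₂ * l₃ + c₃) * Q * T := by
    calc N₂ * q₃ + N₃ ≤ c₂ * Q * (l₃ * T) + c₃ * Q * T :=
          add_le_add (mul_le_mul h₂ hq₃T hq₃ (by positivity))
            (h₃.trans (le_mul_of_one_le_right (hN₃.trans h₃) hT))
      _ = _ := by ring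
  have e₃ : q₂ * (N₂ * q₃ + N₃) ≤ l₂ * (c₂ * l₃ + c₃) * Q * T ^ 2 := by
    calc q₂ * (N₂ * q₃ + N₃) ≤ l₂ * T * (N₂ * q₃ + N₃) :=
          mul_le_mul_of_nonneg_right hq₂ (by positivity)
      _ ≤ l₂ * T * ((c₂ * l₃ + c₃) * Q * T) := mul_le_mul_of_nonneg_left e₂ (by positivity)
      _ = _ := by ring
  have e₄ : 2 ≤ c₄ * Q * T ^ 2 :=
    h₄.trans (le_mul_of_one_le_right (by linarith) (hT.trans hTT))
  linarith

/-- The dominant coefficient is 1/(a²ε), of order R⁴/ε³ when 1/a is of order R²/ε. The lower-order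
terms are absorbed using R ≥ r and ε ≤ 1, and each logarithm is at most a constant times 1 + ln(1 +
R/ε). -/
theorem growthRate_le {ρ β L₀ r K : ℝ} (hρ : 0 < ρ) (hβ0 : 0 < β) (hβ1 : β < 1) (hL₀ : 0 < L₀)
    (hr : 0 < r) (hK : 0 < K) : ∃ C : ℝ, 0 < C ∧ ∀ L R gap ε a : ℝ, 0 ≤ L → L ≤ L₀ → r ≤ R →
      0 ≤ gap → gap ≤ L₀ * R → 0 < ε → ε ≤ 1 → 0 < a → a ≤ 1 → 1 / a ≤ K * (R ^ 2 / ε) →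
      growthRate ρ β L gap ε a ≤ C * (R ^ 4 / ε ^ 3) * (1 + Real.log (1 + R / ε)) ^ 2 := by
  have hβ : 0 < 1 - β := sub_pos.2 hβ1
  set M₁ := L₀ ^ 2 * K / (2 * ρ) with hM₁
  set M₂ := L₀ * K / β with hM₂
  set M₃ := 9 * K ^ 2 / (2 * β ^ 2) with hM₃
  set c₁ := 8 * L₀ ^ 2 * K / (ρ * (1 - β) ^ 2 * r ^ 2) with hc₁
  set c₂ := 8 * L₀ ^ 2 * K ^ 2 / (ρ * (1 - β) ^ 2 * β) with hc₂
  set c₃ := 2 * K / (β * r ^ 2) with hc₃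
  set l₁ := 2 + Real.log (1 + M₁) with hl₁
  set l₂ := 3 + Real.log (1 + M₂) with hl₂
  set l₃ := 4 + Real.log (1 + M₃) with hl₃
  have hM₁0 : 0 < M₁ := by positivity
  have hM₂0 : 0 < M₂ := by positivity
  have hM₃0 : 0 < M₃ := by positivity
  have hl₁0 : 0 < l₁ := add_pos_of_pos_of_nonneg (by norm_num) (Real.log_nonneg (by linarith))
  have hl₂0 : 0 < l₂ := add_pos_of_pos_of_nonneg (by norm_num) (Real.log_nonneg (by linarith))
  have hl₃0 : 0 < l₃ := add_pos_of_pos_of_nonneg (by norm_num) (Real.log_nonneg (by linarith))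
  refine ⟨c₁ * l₁ + l₂ * (c₂ * l₃ + c₃) + 2 / r ^ 4, by positivity, ?_⟩
  intro L R gap ε a hL hLL hrR hgap hgapL hε hε1 ha ha1 hKa
  have hR : 0 < R := hr.trans_le hrR
  set Q := R ^ 4 / ε ^ 3 with hQ
  set T := 1 + Real.log (1 + R / ε) with hT
  have hQ0 : 0 < Q := by positivity
  have hT1 : 1 ≤ T := le_add_of_nonneg_right (Real.log_nonneg (by
    have : 0 < R / ε := by positivity
    linarith))
  have hRQ : R ^ 2 / ε ^ 2 ≤ Q / r ^ 2 := by
    rw [hQ, div_div, div_le_div_iff₀ (by positivity) (by positivity)]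
    have : R ^ 4 * ε ^ 2 = R ^ 2 * ε ^ 2 * R ^ 2 := by ring
    rw [this]
    calc R ^ 2 * (ε ^ 3 * r ^ 2) = R ^ 2 * ε ^ 2 * (ε * r ^ 2) := by ring
      _ ≤ R ^ 2 * ε ^ 2 * (1 * R ^ 2) := by gcongr
      _ = _ := by ring
  have hRQ' : R ^ 2 / ε ≤ R ^ 2 / ε ^ 2 := by
    gcongr
    nlinarith
  have h1Q : 1 ≤ Q / r ^ 4 := by
    rw [le_div_iff₀ (by positivity), one_mul, hQ, le_div_iff₀ (by positivity)]
    calc r ^ 4 * ε ^ 3 ≤ R ^ 4 * 1 ^ 3 := by gcongr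
      _ = R ^ 4 := by ring
  have hb₁ : 8 * L ^ 2 / (ρ * (1 - β) ^ 2 * a * ε) ≤ c₁ * Q := by
    calc 8 * L ^ 2 / (ρ * (1 - β) ^ 2 * a * ε)
        = 8 * L ^ 2 / (ρ * (1 - β) ^ 2) * (1 / a / ε) := by field_simp
      _ ≤ 8 * L₀ ^ 2 / (ρ * (1 - β) ^ 2) * (K * (R ^ 2 / ε) / ε) := by gcongr
      _ = 8 * L₀ ^ 2 / (ρ * (1 - β) ^ 2) * K * (R ^ 2 / ε ^ 2) := by field_simp
      _ ≤ 8 * L₀ ^ 2 / (ρ * (1 - β) ^ 2) * K * (Q / r ^ 2) := by gcongr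
      _ = c₁ * Q := by rw [hc₁]; field_simp
  have ha2 : 1 / a ^ 2 ≤ K ^ 2 * (R ^ 4 / ε ^ 2) := by
    calc 1 / a ^ 2 = (1 / a) ^ 2 := by rw [one_div_pow]
      _ ≤ (K * (R ^ 2 / ε)) ^ 2 := by gcongr
      _ = _ := by ring
  have hb₂ : 8 * L ^ 2 / (ρ * (1 - β) ^ 2 * β * a ^ 2 * ε) ≤ c₂ * Q := by
    calc 8 * L ^ 2 / (ρ * (1 - β) ^ 2 * β * a ^ 2 * ε)
        = 8 * L ^ 2 / (ρ * (1 - β) ^ 2 * β) * (1 / a ^ 2 / ε) := by field_simp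
      _ ≤ 8 * L₀ ^ 2 / (ρ * (1 - β) ^ 2 * β) * (K ^ 2 * (R ^ 4 / ε ^ 2) / ε) := by gcongr
      _ = c₂ * Q := by rw [hc₂, hQ]; field_simp
  have hb₃ : 2 / (β * a) ≤ c₃ * Q := by
    calc 2 / (β * a) = 2 / β * (1 / a) := by field_simp
      _ ≤ 2 / β * (K * (Q / r ^ 2)) := by
        gcongr
        exact hKa.trans (mul_le_mul_of_nonneg_left (hRQ'.trans hRQ) hK.le)
      _ = c₃ * Q := by rw [hc₃]; field_simp
  have hlog₁ : Real.log (L ^ 2 / (2 * ρ * a * ε)) ≤ l₁ * T := by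
    refine log_le_mul_one_add_log (p := 2) (M := M₁) (by positivity) hM₁0.le (by positivity) ?_
    calc L ^ 2 / (2 * ρ * a * ε) = L ^ 2 / (2 * ρ) * (1 / a / ε) := by field_simp
      _ ≤ L₀ ^ 2 / (2 * ρ) * (K * (R ^ 2 / ε) / ε) := by gcongr
      _ = M₁ * (R / ε) ^ 2 := by rw [hM₁]; field_simp
  have hlog₂ : Real.log (gap / (β * a * ε)) ≤ l₂ * T := by
    refine log_le_mul_one_add_log (p := 3) (M := M₂) (by positivity) hM₂0.le (by positivity) ?_
    calc gap / (β * a * ε) = gap / β * (1 / a / ε) := by field_simp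
      _ ≤ L₀ * R / β * (K * (R ^ 2 / ε) / ε) := by gcongr
      _ = M₂ * (R ^ 3 / ε ^ 2) := by rw [hM₂]; field_simp
      _ ≤ M₂ * (R ^ 3 / ε ^ 3) := by
        gcongr ?_ * (_ / ?_)
        exact pow_le_pow_of_le_one hε.le hε1 (by norm_num)
      _ = M₂ * (R / ε) ^ 3 := by rw [div_pow]
  have hlog₃ : Real.log (9 / (2 * a ^ 2 * β ^ 2)) ≤ l₃ * T := by
    refine log_le_mul_one_add_log (p := 4) (M := M₃) (by positivity) hM₃0.le (by positivity) ?_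
    calc 9 / (2 * a ^ 2 * β ^ 2) = 9 / (2 * β ^ 2) * (1 / a ^ 2) := by field_simp
      _ ≤ 9 / (2 * β ^ 2) * (K ^ 2 * (R ^ 4 / ε ^ 2)) := by gcongr
      _ = M₃ * (R ^ 4 / ε ^ 2) := by rw [hM₃]; field_simp
      _ ≤ M₃ * (R ^ 4 / ε ^ 4) := by
        gcongr ?_ * (_ / ?_)
        exact pow_le_pow_of_le_one hε.le hε1 (by norm_num)
      _ = M₃ * (R / ε) ^ 4 := by rw [div_pow]
  have hlog₃0 : 0 ≤ Real.log (9 / (2 * a ^ 2 * β ^ 2)) := by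
    apply Real.log_nonneg
    rw [le_div_iff₀ (by positivity)]
    calc 1 * (2 * a ^ 2 * β ^ 2) ≤ 1 * (2 * 1 ^ 2 * 1 ^ 2) := by gcongr
      _ ≤ 9 := by norm_num
  exact rate_terms_le (by positivity) (by positivity) (by positivity) hlog₃0 hl₁0.le hl₂0.le
    (by positivity) hQ0.le hT1 hb₁ hb₂ hb₃ hlog₁ hlog₂ hlog₃
    (by rw [div_mul_eq_mul_div, mul_div_assoc]; linarith only [h1Q])

theorem bundleRate_distanceBound_le {ρ β L₀ r : ℝ} (hρ : 0 < ρ) (hβ0 : 0 < β) (hβ1 : β < 1)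
    (hL₀ : 0 < L₀) (hr : 0 < r) : ∃ C : ℝ, 0 < C ∧ ∀ L R gap ε : ℝ, 0 ≤ L → L ≤ L₀ → r ≤ R →
      0 ≤ gap → gap ≤ L₀ * R → 0 < ε → ε ≤ 1 →
      bundleRate ρ β L gap (distanceBound ρ β L R) ε ≤
        C * (R ^ 4 / ε ^ 3) * (1 + Real.log (1 + R / ε)) ^ 2 := by
  have hκ : 0 ≤ (1 - β) / β := div_nonneg (by linarith) hβ0.le
  set κ := 2 * (1 + (1 - β) / β) with hκ'
  have hκ0 : 0 < κ := by positivity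
  -- Here 1/a = max{1, ρD̄²/ε}: the first summand handles the value 1, the second handles ρD̄²/ε.
  set K := 1 / r ^ 2 + ρ * (κ * (1 + L₀ ^ 2 / (ρ ^ 2 * r ^ 2))) with hK
  obtain ⟨C, hC, h⟩ := growthRate_le (K := K) hρ hβ0 hβ1 hL₀ hr (by positivity)
  refine ⟨C, hC, fun L R gap ε hL hLL hrR hgap hgapL hε hε1 => ?_⟩
  have hR : 0 < R := hr.trans_le hrR
  have hD : distanceBound ρ β L R ^ 2 = κ * (R ^ 2 + L ^ 2 / ρ ^ 2) :=
    Real.sq_sqrt (by positivity)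
  have hD0 : 0 < distanceBound ρ β L R ^ 2 := by rw [hD]; positivity
  have hDK : distanceBound ρ β L R ^ 2 ≤ κ * (1 + L₀ ^ 2 / (ρ ^ 2 * r ^ 2)) * R ^ 2 := by
    have h1 : L ^ 2 / ρ ^ 2 ≤ L₀ ^ 2 / (ρ ^ 2 * r ^ 2) * R ^ 2 := by
      calc L ^ 2 / ρ ^ 2 ≤ L₀ ^ 2 / ρ ^ 2 := by gcongr
        _ = L₀ ^ 2 / (ρ ^ 2 * r ^ 2) * r ^ 2 := by field_simp
        _ ≤ _ := by gcongr
    rw [hD]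
    calc κ * (R ^ 2 + L ^ 2 / ρ ^ 2)
        ≤ κ * (R ^ 2 + L₀ ^ 2 / (ρ ^ 2 * r ^ 2) * R ^ 2) :=
          mul_le_mul_of_nonneg_left (by linarith only [h1]) hκ0.le
      _ = _ := by ring
  refine h L R gap ε _ hL hLL hrR hgap hgapL hε hε1 (lt_min one_pos (by positivity))
    (min_le_left _ _) ?_
  have h1 : 1 ≤ 1 / r ^ 2 * (R ^ 2 / ε) := by
    rw [one_div, ← div_eq_inv_mul, le_div_iff₀ (by positivity), le_div_iff₀ hε]
    calc 1 * r ^ 2 * ε ≤ 1 * R ^ 2 * 1 := by gcongr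
      _ = R ^ 2 := by ring
  have h2 : ρ * distanceBound ρ β L R ^ 2 / ε ≤
      ρ * (κ * (1 + L₀ ^ 2 / (ρ ^ 2 * r ^ 2))) * (R ^ 2 / ε) := by
    calc ρ * distanceBound ρ β L R ^ 2 / ε
        ≤ ρ * (κ * (1 + L₀ ^ 2 / (ρ ^ 2 * r ^ 2)) * R ^ 2) / ε := by gcongr
      _ = _ := by ring
  rw [hK, add_mul]
  rcases min_choice 1 (ε / (ρ * distanceBound ρ β L R ^ 2)) with h3 | h3
  · rw [h3]
    have : 0 ≤ ρ * distanceBound ρ β L R ^ 2 / ε := by positivity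
    linarith
  · rw [h3, one_div_div]
    linarith

theorem mainTheorem3 (ρ β : ℝ) (hρ : 0 < ρ) (hβ0 : 0 < β) (hβ1 : β < 1) :
    (∀ (n : ℕ) (F : EuclideanSpace ℝ (Fin n) → ℝ), ConvexOn ℝ Set.univ F →
      ∀ x z g : ℕ → EuclideanSpace ℝ (Fin n), IsBundleRun F ρ β x z g →
      ∀ xstar : EuclideanSpace ℝ (Fin n), (∀ y, F xstar ≤ F y) →
        -- the subgradients are bounded
        BddAbove (Set.range fun k => ‖g k‖) ∧
        -- the distance of the iterates to `xstar` is bounded explicitly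
        (∀ k, ‖z k - xstar‖ ≤ distanceBound ρ β (subgradientBound g) ‖x 0 - xstar‖) ∧
        -- the rate with `D` (at least) the explicit distance bound, for every accuracy
        (∀ D : ℝ, 0 < D → distanceBound ρ β (subgradientBound g) ‖x 0 - xstar‖ ≤ D →
          ∀ ε : ℝ, 0 < ε →
            ∃ k : ℕ,
              (k : ℝ) ≤ max 0 (bundleRate ρ β (subgradientBound g) (F (x 0) - F xstar) D ε) ∧
              F (x k) - F xstar ≤ ε) ∧
        -- the rate with any bound `D` on the distances, when `ε ≤ ρ D² / 4`
        (∀ D : ℝ, 0 < D → (∀ k, ‖z k - xstar‖ ≤ D) →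
          ∀ ε : ℝ, 0 < ε → ε ≤ ρ * D ^ 2 / 4 →
            ∃ k : ℕ,
              (k : ℝ) ≤ max 0 (bundleRate ρ β (subgradientBound g) (F (x 0) - F xstar) D ε) ∧
              F (x k) - F xstar ≤ ε)) ∧
    -- up to logarithms, the bound is of order `‖x₀ - x*‖⁴ / ε³`
    (∀ L₀ r : ℝ, 0 < L₀ → 0 < r → ∃ C : ℝ, 0 < C ∧
      ∀ (n : ℕ) (F : EuclideanSpace ℝ (Fin n) → ℝ), ConvexOn ℝ Set.univ F →
      ∀ x z g : ℕ → EuclideanSpace ℝ (Fin n), IsBundleRun F ρ β x z g →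
      ∀ xstar : EuclideanSpace ℝ (Fin n), (∀ y, F xstar ≤ F y) →
        subgradientBound g ≤ L₀ → r ≤ ‖x 0 - xstar‖ →
        ∀ ε : ℝ, 0 < ε → ε ≤ 1 →
          bundleRate ρ β (subgradientBound g) (F (x 0) - F xstar)
              (distanceBound ρ β (subgradientBound g) ‖x 0 - xstar‖) ε ≤
            C * (‖x 0 - xstar‖ ^ 4 / ε ^ 3) *
              (1 + Real.log (1 + ‖x 0 - xstar‖ / ε)) ^ 2) := by
  refine ⟨fun n F hF x z g hrun xs hxs => ?_, fun L₀ r hL₀ hr => ?_⟩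
  · obtain ⟨model, h⟩ := hrun.isCutModelRun hρ hβ1
    have hbdd := bddAbove_norm_subgradient hρ hβ0 hβ1 hF h hxs
    have hL : ∀ k, ‖g k‖ ≤ subgradientBound g := le_ciSup hbdd
    exact ⟨hbdd, dist_trial_le_distanceBound hρ hβ0 hβ1 h hxs hL,
      fun D hD hDD ε hε => exists_le_of_distanceBound_le hρ hβ0 hβ1 hF h hxs hL hD hDD hε,
      fun D hD hzD ε hε hεD => exists_le_of_small hρ hβ0 hβ1 hF h hL hD hzD hε hεD⟩
  · obtain ⟨C, hC, hrate⟩ := bundleRate_distanceBound_le hρ hβ0 hβ1 hL₀ hr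
    refine ⟨C, hC, fun n F hF x z g hrun xs hxs hLL hrR ε hε hε1 => ?_⟩
    obtain ⟨model, h⟩ := hrun.isCutModelRun hρ hβ1
    have hL : ∀ k, ‖g k‖ ≤ subgradientBound g :=
      le_ciSup (bddAbove_norm_subgradient hρ hβ0 hβ1 hF h hxs)
    exact hrate _ _ _ ε ((norm_nonneg _).trans (hL 0)) hLL hrR (sub_nonneg.2 (hxs _))
      (initial_gap_le h fun k => (hL k).trans hLL) hε hε1
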